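/- For a real number $\xi$ let its irrationality exponent $\mu(\xi)\in[1,\infty]$ be the supremum of all real $m$ such that $|\xi-p/q|\le q^{-m}$ holds for infinitely many rational numbers $p/q$ (written in lowest terms with $q\ge 1$), and for $2\le\lambda\le\mu\le\infty$ put $$\mathscr{W}_{\lambda;\mu}=\{\xi\in\mathbb{R}:\ \lambda\le\mu(\xi)\le\mu\}.$$ Let $n\ge 1$, let $\lambda_0,\ldots,\lambda_{n-1}\in[2,\infty]$, put $\Lambda=\lambda_0\lambda_1\cdots\lambda_{n-1}\in[2,\infty]$, and let $\mu_0,\ldots,\mu_{n-1}\in[2,\infty]$ satisfy $\mu_i\ge\lambda_i$ and $$\mu_i>\frac{\Lambda}{\lambda_i-1}+1,\qquad 0\le i\le n-1,$$ where, if $\Lambda=\infty$, this last condition is to be read as $\mu_i=\infty$. Then, with $\dim$ denoting Hausdorff dimension in $\mathbb{R}^n$ and $1/\infty=0$, $$n-1+\frac{2}{\max_{0\le i\le n-1}\lambda_i}\ \ge\ \dim\Big(\prod_{i=0}^{n-1}\mathscr{W}_{\lambda_i;\mu_i}\Big)\ \ge\ \max\Big\{n-1,\ 2\sum_{i=0}^{n-1}\frac1{\lambda_i}\Big\}.$$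 -/

import Mathlib

open scoped ENNReal NNReal

noncomputable section

/-- The irrationality exponent of `ξ`: the supremum, in `[0, ∞]`, of all `m` for which
`|ξ - p/q| ≤ q ^ (-m)` holds for infinitely many rational numbers `p/q`.
A rational number is represented in lowest terms, so `q` is its reduced denominator; for `m ≥ 0`
this is the representation for which the inequality is weakest.  Restricting to `m ≥ 0` does not
affect the supremum, since `m = 0` is always admissible. -/
def irrationalityExponent (ξ : ℝ) : ℝ≥0∞ :=
  ⨆ (m : ℝ≥0) (_ : {r : ℚ | |ξ - (r : ℝ)| ≤ (r.den : ℝ) ^ (-(m : ℝ))}.Infinite), (m : ℝ≥0∞)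

/-- The set `W_{a;b}` of real numbers whose irrationality exponent lies in `[a, b]`. -/
def exponentLevelSet (a b : ℝ≥0∞) : Set ℝ :=
  {ξ : ℝ | a ≤ irrationalityExponent ξ ∧ irrationalityExponent ξ ≤ b}

/-- The Cartesian product `W_{a 0;b 0} × ⋯ × W_{a (n-1);b (n-1)}` as a subset of Euclidean
`n`-space. -/
def exponentLevelProduct {n : ℕ} (a b : Fin n → ℝ≥0∞) : Set (EuclideanSpace ℝ (Fin n)) :=
  {x | ∀ i, x i ∈ exponentLevelSet (a i) (b i)}

end

open MeasureTheory Filter Topology Set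

/-! Upper bound. Only a coordinate `i` with the largest `lam i` is used. Fix `m < lam i`. In a
bounded region, the points with `|x i - p/q| ≤ q ^ (-m)` for some `p` are covered by about `q ^ (1 +
m * (n - 1))` cubes of side `2 * q ^ (-m)`. The `s`-th powers of the diameters are summable over `q`
once `s > n - 1 + 2 / m`, so the covers by all denominators `q ≥ q₀` have total weight tending to
`0` (`hausdorffMeasure_goodApprox_eq_zero`).

Lower bound `2 * ∑ 1 / lam i`. For finite `lam`, a Cantor construction with prime denominators gives
a probability measure whose balls of radius `r` have mass `O(r ^ s)` for every `s < 2 / lam`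
(`law_isFrostman`). Its points have exponent at least `lam` by construction. Almost all have
exponent at most `lam`, since the one-dimensional covering argument makes each set of larger
exponent null for such a measure. An infinite `lam` contributes `0`, and a point mass at a Liouville
number serves. The product of these measures and the mass distribution principle give the bound.

Lower bound `n - 1`. Every line in direction `(1, …, 1)` meets the product set
(`exists_translate_mem_exponentLevelSet`), so the Lipschitz map `x ↦ (x i - x 0)` sends it onto the
whole of `(n - 1)`-space. The point of the line comes from nested intervals: the coordinates are
visited cyclically, and each visit puts one of them at distance about `q ^ (-lam i)` from a dyadic
fraction of denominator `q`, the next denominator being about `q ^ lam i`. Between two visits to the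
same coordinate the denominator is thus raised to about the power `Λ = ∏ lam j`. Any other fraction
is kept away by the separation `1 / (b * q)` of distinct fractions, so the exponent is at most `max
(lam i) (Λ / (lam i - 1) + 1)`, which the hypothesis on `mu i` allows. -/

/-! ### Good approximations and the irrationality exponent -/

/-- The rationals approximating `ξ` with exponent `m`. -/
def goodApprox (ξ m : ℝ) : Set ℚ := {r : ℚ | |ξ - (r : ℝ)| ≤ (r.den : ℝ) ^ (-m)}

lemma one_le_den_cast (r : ℚ) : (1 : ℝ) ≤ r.den := by exact_mod_cast r.pos

lemma goodApprox_anti {ξ m m' : ℝ} (h : m ≤ m') : goodApprox ξ m' ⊆ goodApprox ξ m := fun r hr =>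
  le_trans (show |ξ - (r : ℝ)| ≤ (r.den : ℝ) ^ (-m') from hr)
    (Real.rpow_le_rpow_of_exponent_le (one_le_den_cast r) (by linarith))

lemma abs_sub_le_one_of_mem_goodApprox {ξ m : ℝ} (hm : 0 ≤ m) {r : ℚ} (hr : r ∈ goodApprox ξ m) :
    |ξ - (r : ℝ)| ≤ 1 :=
  le_trans (show |ξ - (r : ℝ)| ≤ (r.den : ℝ) ^ (-m) from hr)
    (Real.rpow_le_one_of_one_le_of_nonpos (one_le_den_cast r) (by linarith))

lemma irrationalityExponent_le {ξ : ℝ} {b : ℝ≥0∞}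
    (h : ∀ m : ℝ≥0, b < m → (goodApprox ξ m).Finite) : irrationalityExponent ξ ≤ b := by
  refine iSup_le fun m => iSup_le fun hm => ?_
  by_contra! hb
  exact hm (h m hb)

lemma le_irrationalityExponent {ξ : ℝ} {a : ℝ≥0∞}
    (h : ∀ m : ℝ≥0, (m : ℝ≥0∞) < a → (goodApprox ξ m).Infinite) : a ≤ irrationalityExponent ξ := by
  refine ENNReal.le_of_forall_nnreal_lt fun m hm => ?_
  exact le_iSup₂ (f := fun (m : ℝ≥0)
    (_ : {r : ℚ | |ξ - (r : ℝ)| ≤ (r.den : ℝ) ^ (-(m : ℝ))}.Infinite) => (m : ℝ≥0∞)) m (h m hm)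

lemma infinite_goodApprox_of_lt {ξ : ℝ} {m : ℝ≥0} (h : (m : ℝ≥0∞) < irrationalityExponent ξ) :
    (goodApprox ξ m).Infinite := by
  obtain ⟨m', hm'⟩ := lt_iSup_iff.1 h
  obtain ⟨hinf, hlt⟩ := lt_iSup_iff.1 hm'
  exact Set.Infinite.mono (goodApprox_anti (by exact_mod_cast hlt.le)) hinf

lemma finite_rat_den_le (ξ : ℝ) (N : ℕ) :
    {r : ℚ | |ξ - (r : ℝ)| ≤ 1 ∧ r.den ≤ N}.Finite := by
  set K : ℤ := ⌈(N : ℝ) * (|ξ| + 1)⌉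
  refine (((Set.finite_Icc (-K) K).prod (Set.finite_Icc 0 N)).image
    (fun z : ℤ × ℕ => (z.1 : ℚ) / z.2)).subset ?_
  rintro r ⟨h1, h2⟩
  refine ⟨(r.num, r.den), ⟨?_, ⟨Nat.zero_le _, h2⟩⟩, r.num_div_den⟩
  have hr : |(r : ℝ)| ≤ |ξ| + 1 := by
    have := abs_sub_abs_le_abs_sub (r : ℝ) ξ
    rw [abs_sub_comm] at this
    linarith
  have hnum : |(r.num : ℝ)| ≤ K := by
    have h3 : (r.num : ℝ) = r * r.den := by exact_mod_cast (Rat.mul_den_eq_num r).symm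
    rw [h3, abs_mul, Nat.abs_cast, mul_comm]
    refine le_trans ?_ (Int.le_ceil _)
    have : (r.den : ℝ) ≤ N := by exact_mod_cast h2
    gcongr
  have := abs_le.1 hnum
  exact ⟨by exact_mod_cast this.1, by exact_mod_cast this.2⟩

lemma finite_goodApprox_of_den_le {ξ m : ℝ} (hm : 0 ≤ m) (N : ℕ)
    (h : ∀ r ∈ goodApprox ξ m, r.den ≤ N) : (goodApprox ξ m).Finite :=
  (finite_rat_den_le ξ N).subset fun r hr => ⟨abs_sub_le_one_of_mem_goodApprox hm hr, h r hr⟩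

lemma exists_den_gt_of_infinite_goodApprox {ξ m : ℝ} (hm : 0 ≤ m)
    (h : (goodApprox ξ m).Infinite) (N : ℕ) : ∃ r ∈ goodApprox ξ m, N < r.den := by
  by_contra! hc
  exact h (finite_goodApprox_of_den_le hm N hc)

lemma infinite_of_forall_exists_den_gt {A : Set ℚ} (h : ∀ N : ℕ, ∃ r ∈ A, N < r.den) :
    A.Infinite := by
  intro hfin
  obtain ⟨N, hN⟩ := (hfin.image Rat.den).bddAbove
  obtain ⟨r, hr, hlt⟩ := h N
  exact absurd (hN ⟨r, hr, rfl⟩) (not_le.2 hlt)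

/-! ### Upper bound by covering with grids -/

lemma card_Icc_neg_ceil_le {B : ℝ} (hB : 1 ≤ B) :
    ((Finset.Icc (-⌈B⌉) ⌈B⌉).card : ℝ) ≤ 5 * B := by
  have h0 : 0 ≤ ⌈B⌉ := Int.ceil_nonneg (by linarith)
  rw [Int.card_Icc]
  have : (((⌈B⌉ + 1 - -⌈B⌉).toNat : ℤ) : ℝ) = 2 * ⌈B⌉ + 1 := by
    rw [Int.toNat_of_nonneg (by linarith)]; push_cast; ring
  have h2 := Int.ceil_lt_add_one B
  rw [Int.cast_natCast] at this
  rw [this]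
  linarith

/-- Exponents of the grid used to cover the points with good approximations in direction `i`. -/
def gridExponent {ι : Type*} [DecidableEq ι] (i : ι) (m : ℝ) (j : ι) : ℝ := if j = i then 1 else m

lemma gridExponent_nonneg {ι : Type*} [DecidableEq ι] (i : ι) {m : ℝ} (hm : 0 ≤ m) (j : ι) :
    0 ≤ gridExponent i m j := by
  unfold gridExponent; split_ifs <;> linarith

section UpperBound

variable {ι : Type*} [Fintype ι] [DecidableEq ι]

lemma sum_gridExponent (i : ι) (m : ℝ) :
    ∑ j, gridExponent i m j = 1 + m * ((Fintype.card ι : ℝ) - 1) := by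
  have : ∀ j, gridExponent i m j = m + if j = i then 1 - m else 0 := by
    intro j; unfold gridExponent; split_ifs <;> ring
  simp only [this, Finset.sum_add_distrib, Finset.sum_const, Finset.sum_ite_eq', Finset.mem_univ,
    if_true, Finset.card_univ, nsmul_eq_mul]
  ring

/-- The grid coordinates relevant for points of norm at most `N`. -/
noncomputable def gridIndex (i : ι) (m : ℝ) (N q : ℕ) : Finset (ι → ℤ) :=
  Fintype.piFinset fun j =>
    Finset.Icc (-⌈((N : ℝ) + 1) * (q : ℝ) ^ gridExponent i m j⌉)
      ⌈((N : ℝ) + 1) * (q : ℝ) ^ gridExponent i m j⌉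

lemma card_gridIndex_le (i : ι) {m : ℝ} (hm : 0 ≤ m) (N : ℕ) {q : ℕ} (hq : 1 ≤ q) :
    ((gridIndex i m N q).card : ℝ) ≤
      (5 * ((N : ℝ) + 1)) ^ Fintype.card ι * (q : ℝ) ^ (1 + m * ((Fintype.card ι : ℝ) - 1)) := by
  have hq' : (1 : ℝ) ≤ q := by exact_mod_cast hq
  rw [gridIndex, Fintype.card_piFinset, Nat.cast_prod, ← sum_gridExponent i m,
    Real.rpow_sum_of_pos (by linarith), ← Finset.card_univ, ← Finset.prod_const,
    ← Finset.prod_mul_distrib]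
  refine Finset.prod_le_prod (fun _ _ => by positivity) fun j _ => ?_
  have h1 := Real.one_le_rpow hq' (gridExponent_nonneg i hm j)
  have h2 : (1 : ℝ) ≤ (N : ℝ) + 1 := by linarith [Nat.cast_nonneg (α := ℝ) N]
  have := card_Icc_neg_ceil_le (B := ((N : ℝ) + 1) * (q : ℝ) ^ gridExponent i m j) (by nlinarith)
  linarith

/-- The cell of the grid with denominator `q` and coordinates `k`. -/
def gridCell (i : ι) (m : ℝ) (q : ℕ) (k : ι → ℤ) : Set (ι → ℝ) :=
  Metric.closedBall (fun j => (k j : ℝ) / (q : ℝ) ^ gridExponent i m j) ((q : ℝ) ^ (-m))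

lemma ediam_gridCell_le (i : ι) (m : ℝ) (q : ℕ) (k : ι → ℤ) :
    Metric.ediam (gridCell i m q k) ≤ ENNReal.ofReal (2 * (q : ℝ) ^ (-m)) := by
  refine (Metric.ediam_le_of_forall_dist_le fun x hx y hy => ?_)
  have := dist_triangle_right x y (fun j => (k j : ℝ) / (q : ℝ) ^ gridExponent i m j)
  have h1 : dist x _ ≤ _ := hx
  have h2 : dist y _ ≤ _ := hy
  linarith

lemma exists_mem_gridCell (i : ι) {m : ℝ} (hm : 0 ≤ m) (N : ℕ) {x : ι → ℝ}
    (hx : ∀ j, |x j| ≤ N) {r : ℚ} (hr : r ∈ goodApprox (x i) m) :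
    ∃ k ∈ gridIndex i m N r.den, x ∈ gridCell i m r.den k := by
  have hq := one_le_den_cast r
  have hq0 : (0 : ℝ) < r.den := by linarith
  -- In direction `i` the cell is centred at `r` itself; in the others `x j` is rounded down to a
  -- multiple of `q ^ (-m)`.
  refine ⟨fun j => if j = i then r.num else ⌊x j * (r.den : ℝ) ^ m⌋, ?_, ?_⟩
  · refine Fintype.mem_piFinset.2 fun j => ?_
    suffices h : |(((if j = i then r.num else ⌊x j * (r.den : ℝ) ^ m⌋ : ℤ)) : ℝ)| ≤
        ⌈((N : ℝ) + 1) * (r.den : ℝ) ^ gridExponent i m j⌉ by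
      have := abs_le.1 h
      exact Finset.mem_Icc.2 ⟨by exact_mod_cast this.1, by exact_mod_cast this.2⟩
    refine le_trans ?_ (Int.le_ceil _)
    unfold gridExponent
    split_ifs with hj
    · have h1 := abs_sub_le_one_of_mem_goodApprox hm hr
      have h2 := abs_sub_abs_le_abs_sub (r : ℝ) (x i)
      rw [abs_sub_comm] at h2
      have h3 : (r.num : ℝ) = r * r.den := by exact_mod_cast (Rat.mul_den_eq_num r).symm
      rw [h3, abs_mul, Nat.abs_cast, Real.rpow_one]
      have := hx i
      gcongr
      linarith
    · have h1 := Real.one_le_rpow hq hm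
      have h2 := Int.floor_le (x j * (r.den : ℝ) ^ m)
      have h3 := Int.lt_floor_add_one (x j * (r.den : ℝ) ^ m)
      have h4 := abs_le.1 (hx j)
      rw [abs_le]
      constructor <;> nlinarith
  · refine (dist_pi_le_iff (by positivity)).2 fun j => ?_
    rw [Real.dist_eq]
    unfold gridExponent
    by_cases hj : j = i
    · simp only [hj, if_true]
      have : |x i - (r : ℝ)| ≤ (r.den : ℝ) ^ (-m) := hr
      rw [Real.rpow_one]
      convert this using 3
      exact_mod_cast r.num_div_den
    · simp only [hj, if_false]
      have hp : (0 : ℝ) < (r.den : ℝ) ^ m := by positivity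
      have h2 := Int.floor_le (x j * (r.den : ℝ) ^ m)
      have h3 := Int.lt_floor_add_one (x j * (r.den : ℝ) ^ m)
      have h5 : x j - (⌊x j * (r.den : ℝ) ^ m⌋ : ℝ) / (r.den : ℝ) ^ m =
        (x j * (r.den : ℝ) ^ m - ⌊x j * (r.den : ℝ) ^ m⌋) * (r.den : ℝ) ^ (-m) := by
        rw [Real.rpow_neg hq0.le]; field_simp
      rw [h5, abs_mul, abs_of_nonneg (by linarith), abs_of_nonneg (by positivity)]
      have : (0 : ℝ) ≤ (r.den : ℝ) ^ (-m) := by positivity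
      nlinarith

lemma hausdorffMeasure_goodApprox_eq_zero (i : ι) {m s : ℝ} (hm : 0 < m)
    (hs0 : 0 ≤ s) (hs : (Fintype.card ι : ℝ) - 1 + 2 / m < s) (N : ℕ) :
    μH[s] {x : ι → ℝ | (∀ j, |x j| ≤ N) ∧ (goodApprox (x i) m).Infinite} = 0 := by
  -- The exponent of `q` in (number of cells) * (diameter) ^ `s`.
  set a : ℝ := 1 + m * ((Fintype.card ι : ℝ) - 1) - m * s with ha
  have ha1 : a < -1 := by
    have : m * ((Fintype.card ι : ℝ) - 1 + 2 / m) < m * s := by gcongr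
    have h2 : m * (2 / m) = 2 := by field_simp
    rw [mul_add, h2] at this
    linarith
  set C : ℝ := (5 * ((N : ℝ) + 1)) ^ Fintype.card ι * 2 ^ s with hC
  have hsum : Summable fun q : ℕ => C * (q : ℝ) ^ a :=
    (Real.summable_nat_rpow.2 ha1).mul_left C
  have hf : ∑' q : ℕ, ENNReal.ofReal (C * (q : ℝ) ^ a) ≠ ∞ :=
    hsum.tsum_ofReal_ne_top
  have htail := ENNReal.tendsto_sum_nat_add (fun q : ℕ => ENNReal.ofReal (C * (q : ℝ) ^ a)) hf
  have hr : Tendsto (fun q0 : ℕ => ENNReal.ofReal (2 * (q0 : ℝ) ^ (-m))) atTop (𝓝 0) := by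
    rw [← ENNReal.ofReal_zero, ← mul_zero (2 : ℝ)]
    exact ENNReal.tendsto_ofReal
      (((tendsto_rpow_neg_atTop hm).comp tendsto_natCast_atTop_atTop).const_mul 2)
  -- The cover numbered `q0` uses all cells of denominator `q + q0`; infinitely many good
  -- approximations ensure that one has a denominator this large.
  have key := Measure.hausdorffMeasure_le_liminf_tsum
    (ι := fun q0 : ℕ => Σ q : ℕ, gridIndex i m N (q + q0)) s
    {x : ι → ℝ | (∀ j, |x j| ≤ N) ∧ (goodApprox (x i) m).Infinite} _ hr
    (fun q0 z => gridCell i m (z.1 + q0) z.2.1) ?_ ?_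
  · refine le_antisymm (key.trans ?_) zero_le
    rw [← htail.liminf_eq]
    refine liminf_le_liminf ?_
    filter_upwards [eventually_ge_atTop 1] with q0 hq0
    rw [ENNReal.tsum_sigma fun q (k : gridIndex i m N (q + q0)) =>
      Metric.ediam (gridCell i m (q + q0) k.1) ^ s]
    refine ENNReal.tsum_le_tsum fun q => ?_
    have hq : 1 ≤ q + q0 := by omega
    have hq1 : (0 : ℝ) < ((q + q0 : ℕ) : ℝ) := by exact_mod_cast hq
    calc ∑' k : gridIndex i m N (q + q0), Metric.ediam (gridCell i m (q + q0) k.1) ^ s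
        ≤ ∑' k : gridIndex i m N (q + q0), ENNReal.ofReal (2 * ((q + q0 : ℕ) : ℝ) ^ (-m)) ^ s :=
          ENNReal.tsum_le_tsum fun k => ENNReal.rpow_le_rpow (ediam_gridCell_le _ _ _ _) hs0
      _ = ENNReal.ofReal ((gridIndex i m N (q + q0)).card * (2 * ((q + q0 : ℕ) : ℝ) ^ (-m)) ^ s) := by
          rw [tsum_fintype, Finset.sum_const, Finset.card_univ, Fintype.card_coe, nsmul_eq_mul,
            ENNReal.ofReal_rpow_of_nonneg (by positivity) hs0, ENNReal.ofReal_mul (by positivity),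
            ENNReal.ofReal_natCast]
      _ ≤ _ := by
          refine ENNReal.ofReal_le_ofReal ?_
          refine (mul_le_mul_of_nonneg_right (card_gridIndex_le i hm.le N hq)
            (by positivity)).trans_eq ?_
          rw [Real.mul_rpow (by norm_num) (by positivity), ← Real.rpow_mul hq1.le, hC,
            show a = (1 + m * ((Fintype.card ι : ℝ) - 1)) + -m * s by rw [ha]; ring,
            Real.rpow_add hq1 (1 + _)]
          ring
  · filter_upwards [eventually_ge_atTop 1] with q0 hq0 z
    refine (ediam_gridCell_le _ _ _ _).trans (ENNReal.ofReal_le_ofReal ?_)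
    have : (0 : ℝ) < q0 := by exact_mod_cast hq0
    refine mul_le_mul_of_nonneg_left
      (Real.rpow_le_rpow_of_nonpos this (by push_cast; linarith [Nat.cast_nonneg (α := ℝ) z.1])
        (by linarith)) (by norm_num)
  · refine Eventually.of_forall fun q0 => ?_
    rintro x ⟨hxN, hx⟩
    obtain ⟨r, hr, hlt⟩ := exists_den_gt_of_infinite_goodApprox hm.le hx q0
    obtain ⟨k, hk, hxk⟩ := exists_mem_gridCell i hm.le N hxN hr
    obtain ⟨q, hq⟩ := Nat.exists_eq_add_of_le' hlt.le
    rw [hq] at hk hxk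
    exact mem_iUnion.2 ⟨⟨q, k, hk⟩, hxk⟩

lemma dimH_setOf_infinite_goodApprox_le (i : ι) {m s : ℝ≥0} (hm : 0 < m)
    (hs : (Fintype.card ι : ℝ) - 1 + 2 / m < s) :
    dimH {x : ι → ℝ | (goodApprox (x i) m).Infinite} ≤ s := by
  have hcov : {x : ι → ℝ | (goodApprox (x i) m).Infinite} ⊆
      ⋃ N : ℕ, {x : ι → ℝ | (∀ j, |x j| ≤ N) ∧ (goodApprox (x i) m).Infinite} := by
    intro x hx
    obtain ⟨N, hN⟩ := exists_nat_ge ‖x‖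
    exact mem_iUnion.2 ⟨N, fun j => (norm_le_pi_norm x j).trans hN, hx⟩
  refine (dimH_mono hcov).trans ?_
  rw [dimH_iUnion]
  refine iSup_le fun N => dimH_le_of_hausdorffMeasure_ne_top ?_
  exact (hausdorffMeasure_goodApprox_eq_zero i (by exact_mod_cast hm) s.2 hs N).trans_ne
    ENNReal.zero_ne_top

end UpperBound

/-- Apply the preceding bound to finite `m < a` and let `m` increase to `a`; this also covers `a =
∞`, where `2 / m` tends to `0`. -/
lemma dimH_le_of_le_irrationalityExponent {ι : Type*} [Fintype ι] (i : ι) {a : ℝ≥0∞} (ha : 0 < a) :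
    dimH {x : ι → ℝ | a ≤ irrationalityExponent (x i)} ≤
      ((Fintype.card ι : ℝ≥0∞) - 1) + 2 / a := by
  classical
  refine le_of_forall_gt_imp_ge_of_dense fun s hs => ?_
  have hcont : Tendsto (fun m : ℝ≥0∞ => ((Fintype.card ι : ℝ≥0∞) - 1) + 2 / m) (𝓝[<] a)
      (𝓝 (((Fintype.card ι : ℝ≥0∞) - 1) + 2 / a)) :=
    ((ENNReal.Tendsto.const_div tendsto_id (Or.inr (by norm_num))).const_add _).mono_left
      nhdsWithin_le_nhds
  have : (𝓝[<] a).NeBot := nhdsLT_neBot_of_exists_lt ⟨0, ha⟩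
  obtain ⟨m, hms, hma, hm0⟩ := ((hcont.eventually_lt_const hs).and
    ((eventually_mem_nhdsWithin (a := a) (s := Iio a)).and
      (mem_nhdsWithin_of_mem_nhds (Ioi_mem_nhds ha)))).exists
  rcases eq_or_ne s ∞ with rfl | hs'
  · exact le_top
  lift s to ℝ≥0 using hs'
  lift m to ℝ≥0 using (lt_of_lt_of_le hma le_top).ne
  have hm0' : 0 < m := by simpa using hm0
  refine (dimH_mono fun x hx => ?_).trans (dimH_setOf_infinite_goodApprox_le i hm0' ?_)
  · exact infinite_goodApprox_of_lt (lt_of_lt_of_le hma hx)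
  · obtain ⟨c, hc⟩ := Nat.exists_eq_succ_of_ne_zero (Fintype.card_pos_iff.2 ⟨i⟩).ne'
    have h2 : ((2 : ℝ≥0) : ℝ≥0∞) / (m : ℝ≥0∞) = ((2 / m : ℝ≥0) : ℝ≥0∞) :=
      (ENNReal.coe_div hm0'.ne').symm
    simp only [hc, Nat.succ_eq_add_one, Nat.cast_add, Nat.cast_one] at hms ⊢
    rw [ENNReal.add_sub_cancel_right ENNReal.one_ne_top, ← ENNReal.coe_ofNat, h2] at hms
    have h3 : (c : ℝ≥0) + 2 / m < s := by exact_mod_cast hms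
    have h4 : (c : ℝ) + 2 / m < s := by exact_mod_cast h3
    linarith

/-! ### Frostman measures and the mass distribution principle -/

section MassDistribution

variable {X : Type*} [MetricSpace X] [MeasurableSpace X]

/-- A measure is `s`-Frostman with constant `C` if balls of radius `r` have measure at most
`C * r ^ s`. -/
def IsFrostman (ν : Measure X) (C s : ℝ) : Prop :=
  ∀ (x : X) (r : ℝ), 0 < r → ν (Metric.closedBall x r) ≤ ENNReal.ofReal (C * r ^ s)

/-- A set lies in the closed ball about any of its points with radius any `r > diam U`. Letting `r`
decrease to the diameter also handles diameter `0`, which the definition excludes. -/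
lemma IsFrostman.measure_le {ν : Measure X} {C s : ℝ} (h : IsFrostman ν C s) (hs : 0 ≤ s)
    {U : Set X} (hne : U.Nonempty) (hU : Bornology.IsBounded U) :
    ν U ≤ ENNReal.ofReal (C * Metric.diam U ^ s) := by
  obtain ⟨x, hx⟩ := hne
  have hlim : Tendsto (fun r : ℝ => ENNReal.ofReal (C * r ^ s)) (𝓝[>] Metric.diam U)
      (𝓝 (ENNReal.ofReal (C * Metric.diam U ^ s))) :=
    ENNReal.tendsto_ofReal (((Real.continuousAt_rpow_const _ s (Or.inr hs)).tendsto.const_mul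
      C).mono_left nhdsWithin_le_nhds)
  refine ge_of_tendsto hlim ?_
  filter_upwards [self_mem_nhdsWithin] with r hr
  have hlt : Metric.diam U < r := hr
  refine (measure_mono fun y hy => ?_).trans (h x r (Metric.diam_nonneg.trans_lt hlt))
  exact (Metric.dist_le_diam_of_mem hU hy hx).trans hlt.le

/-- The mass distribution principle. -/
lemma IsFrostman.measure_eq_zero [BorelSpace X] {ν : Measure X} {C s : ℝ} (h : IsFrostman ν C s) (hs : 0 ≤ s)
    {S : Set X} (hS : μH[s] S = 0) : ν S = 0 := by
  set D : ℝ := max C 1 with hD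
  have hD0 : 0 < D := lt_of_lt_of_le one_pos (le_max_right _ _)
  have hle : (ENNReal.ofReal D)⁻¹ • ν ≤ μH[s] := by
    refine Measure.le_hausdorffMeasure s _ 1 one_pos fun U hU => ?_
    rcases U.eq_empty_or_nonempty with rfl | hne
    · simp
    have hUfin : Metric.ediam U ≠ ∞ := (hU.trans_lt ENNReal.one_lt_top).ne
    have hUb : Bornology.IsBounded U := Metric.isBounded_iff_ediam_ne_top.2 hUfin
    have h1 := h.measure_le hs hne hUb
    have h2 : ENNReal.ofReal (C * Metric.diam U ^ s) ≤ ENNReal.ofReal D * Metric.ediam U ^ s := by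
      have h3 : Metric.ediam U = ENNReal.ofReal (Metric.diam U) := by
        rw [Metric.diam, ENNReal.ofReal_toReal hUfin]
      rw [h3, ENNReal.ofReal_rpow_of_nonneg Metric.diam_nonneg hs, ← ENNReal.ofReal_mul hD0.le]
      refine ENNReal.ofReal_le_ofReal (mul_le_mul_of_nonneg_right (le_max_left _ _) ?_)
      exact Real.rpow_nonneg Metric.diam_nonneg s
    rw [Measure.smul_apply, smul_eq_mul, mul_comm, ← div_eq_mul_inv]
    refine ENNReal.div_le_of_le_mul ?_
    rw [mul_comm]
    exact h1.trans h2
  have h0 := hle S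
  rw [hS, nonpos_iff_eq_zero, Measure.smul_apply, smul_eq_mul, mul_eq_zero] at h0
  rcases h0 with h0 | h0
  · exact absurd h0 (ENNReal.inv_ne_zero.2 ENNReal.ofReal_ne_top)
  · exact h0

end MassDistribution

lemma hausdorffMeasure_setOf_infinite_goodApprox_real {m s : ℝ} (hm : 0 < m) (hs : 2 / m < s) :
    μH[s] {x : ℝ | (goodApprox x m).Infinite} = 0 := by
  have hs0 : 0 ≤ s := le_trans (by positivity) hs.le
  have hcov : {x : ℝ | (goodApprox x m).Infinite} ⊆ ⋃ N : ℕ,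
      (IsometryEquiv.funUnique Unit ℝ) '' {x : Unit → ℝ | (∀ j, |x j| ≤ N) ∧
        (goodApprox (x ()) m).Infinite} := by
    intro x hx
    obtain ⟨N, hN⟩ := exists_nat_ge |x|
    exact mem_iUnion.2 ⟨N, fun _ => x, ⟨fun _ => hN, hx⟩, rfl⟩
  refine measure_mono_null hcov (measure_iUnion_null fun N => ?_)
  rw [IsometryEquiv.hausdorffMeasure_image]
  exact hausdorffMeasure_goodApprox_eq_zero () hm hs0 (by simpa using hs) N

/-- A measure with all Frostman exponents below `2 / lam` gives full measure to the numbers with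
irrationality exponent at most `lam`. -/
lemma ae_irrationalityExponent_le {ν : Measure ℝ} {lam : ℝ≥0} (hlam : 0 < lam)
    (hν : ∀ s : ℝ, 0 ≤ s → s < 2 / lam → ∃ C, IsFrostman ν C s) :
    ∀ᵐ x ∂ν, irrationalityExponent x ≤ lam := by
  -- A sequence decreasing to `lam` reduces the claim to countably many null sets.
  obtain ⟨u, -, hu, hlim⟩ := exists_seq_strictAnti_tendsto lam
  have hfin : ∀ᵐ x ∂ν, ∀ k, (goodApprox x (u k)).Finite := by
    refine ae_all_iff.2 fun k => ?_
    have hlt : (2 : ℝ) / u k < 2 / lam := by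
      have h1 : (lam : ℝ) < u k := by exact_mod_cast hu k
      have h2 : (0 : ℝ) < lam := by exact_mod_cast hlam
      gcongr
    obtain ⟨s, hs1, hs2⟩ := exists_between hlt
    have hs0 : 0 ≤ s := le_trans (by positivity) hs1.le
    obtain ⟨C, hC⟩ := hν s hs0 hs2
    exact hC.measure_eq_zero hs0 (hausdorffMeasure_setOf_infinite_goodApprox_real
      (by exact_mod_cast hlam.trans (hu k)) hs1)
  filter_upwards [hfin] with x hx
  refine irrationalityExponent_le fun m hm => ?_
  obtain ⟨k, hk⟩ := (hlim.eventually_lt_const (show lam < m by exact_mod_cast hm)).exists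
  exact (hx k).subset (goodApprox_anti (by exact_mod_cast hk.le))

lemma IsFrostman.measure_rat_eq_zero {ν : Measure ℝ} {C s : ℝ} (h : IsFrostman ν C s)
    (hs : 0 < s) : ∀ᵐ x ∂ν, Irrational x := by
  have hc : (Set.range ((↑) : ℚ → ℝ)).Countable := Set.countable_range _
  suffices hnull : ν (Set.range ((↑) : ℚ → ℝ)) = 0 from measure_eq_zero_iff_ae_notMem.1 hnull
  rw [← Set.biUnion_of_singleton (Set.range ((↑) : ℚ → ℝ))]
  refine (measure_biUnion_null_iff hc).2 fun x _ => ?_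
  have := h.measure_le hs.le (singleton_nonempty x) Bornology.isBounded_singleton
  simpa [Real.zero_rpow hs.ne'] using this

/-! ### Dyadic blocks with many primes -/

section Primes

/-- The primes in `[Q, 2 * Q)`. -/
def primeBlock (Q : ℕ) : Finset ℕ := (Finset.Ico Q (2 * Q)).filter Nat.Prime

/-- Otherwise the block at `2 ^ j` would contribute at most `1 / (j + 1) ^ 2` to the sum of
reciprocals of primes for every `j ≥ J`, and that sum would converge. -/
lemma exists_card_primeBlock_ge (J : ℕ) :
    ∃ j ≥ J, (2 : ℝ) ^ j / ((j : ℝ) + 1) ^ 2 ≤ (primeBlock (2 ^ j)).card := by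
  by_contra! hcon
  set f : ℕ → ℝ := Set.indicator {p : ℕ | p.Prime} (fun n : ℕ => (1 : ℝ) / n) with hf
  have hf0 : ∀ n, 0 ≤ f n := fun n => Set.indicator_nonneg (fun _ _ => by positivity) n
  have hblock : ∀ j ≥ J, ∑ n ∈ Finset.Ico (2 ^ j) (2 ^ (j + 1)), f n ≤ 1 / ((j : ℝ) + 1) ^ 2 := by
    intro j hj
    have h1 : ∑ n ∈ Finset.Ico (2 ^ j) (2 ^ (j + 1)), f n = ∑ n ∈ primeBlock (2 ^ j), (1 : ℝ) / n := by
      rw [primeBlock, Finset.sum_filter, show 2 * 2 ^ j = 2 ^ (j + 1) by ring]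
      exact Finset.sum_congr rfl fun n _ => by simp [hf, Set.indicator_apply]
    rw [h1]
    have h2 : ∀ n ∈ primeBlock (2 ^ j), (1 : ℝ) / n ≤ 1 / 2 ^ j := by
      intro n hn
      have : 2 ^ j ≤ n := (Finset.mem_Ico.1 (Finset.mem_filter.1 hn).1).1
      have : (2 : ℝ) ^ j ≤ n := by exact_mod_cast this
      gcongr
    refine (Finset.sum_le_card_nsmul _ _ _ h2).trans ?_
    rw [nsmul_eq_mul]
    have := (hcon j hj).le
    calc _ ≤ (2 : ℝ) ^ j / ((j : ℝ) + 1) ^ 2 * (1 / 2 ^ j) := by gcongr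
      _ = _ := by field_simp
  have hsq : Summable fun j : ℕ => 1 / ((j : ℝ) + 1) ^ 2 := by
    have := (summable_nat_add_iff 1).2 (Real.summable_one_div_nat_pow.2 (show 1 < 2 by norm_num))
    simpa using this
  have hpart : ∀ i, ∑ n ∈ Finset.range (2 ^ (J + i)), f n ≤
      ∑ n ∈ Finset.range (2 ^ J), f n + ∑ j ∈ Finset.range (J + i), 1 / ((j : ℝ) + 1) ^ 2 := by
    intro i
    induction i with
    | zero => simpa using Finset.sum_nonneg fun j _ => by positivity
    | succ i ih =>
      rw [← add_assoc, ← Finset.sum_range_add_sum_Ico f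
        (Nat.pow_le_pow_right (by norm_num) (Nat.le_succ (J + i))), Finset.sum_range_succ]
      have := hblock (J + i) (by omega)
      linarith
  refine not_summable_one_div_on_primes (summable_of_sum_range_le
    (c := ∑ n ∈ Finset.range (2 ^ J), f n + ∑' j : ℕ, 1 / ((j : ℝ) + 1) ^ 2) hf0 fun n => ?_)
  have h1 : n ≤ 2 ^ (J + n) := (Nat.lt_two_pow_self).le.trans
    (Nat.pow_le_pow_right (by norm_num) (by omega))
  calc _ ≤ ∑ n ∈ Finset.range (2 ^ (J + n)), f n :=
        Finset.sum_le_sum_of_subset_of_nonneg (by simpa using h1) fun i _ _ => hf0 i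
    _ ≤ _ := hpart n
    _ ≤ _ := by
      have := hsq.sum_le_tsum (Finset.range (J + n)) fun j _ => by positivity
      linarith

/-- With `Q = 2 ^ j` the product is at least a constant times `Q ^ 2 / (j + 1) ^ 2`, and `Q ^ ε`
absorbs the logarithmic loss. -/
lemma exists_large_primeBlock {L ε : ℝ} (hL : 0 < L) (hε : 0 < ε) (Q₀ : ℕ) :
    ∃ Q ≥ Q₀, (Q : ℝ) ^ (2 - ε) ≤ (primeBlock Q).card * ⌊(Q : ℝ) * L / 4⌋₊ := by
  have hgrow : Tendsto (fun j : ℕ => ((2 : ℝ) ^ ε) ^ j / ((j : ℝ) + 1) ^ 2) atTop atTop := by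
    have hb : 1 < (2 : ℝ) ^ ε := Real.one_lt_rpow (by norm_num) hε
    have h1 := (tendsto_pow_const_div_const_pow_of_one_lt 2 hb).comp (tendsto_add_atTop_nat 1)
    have h2 : Tendsto (fun j : ℕ => ((j : ℝ) + 1) ^ 2 / ((2 : ℝ) ^ ε) ^ j) atTop (𝓝[>] 0) := by
      refine tendsto_nhdsWithin_iff.2 ⟨?_, Eventually.of_forall fun j => ?_⟩
      · have h3 := h1.const_mul ((2 : ℝ) ^ ε)
        rw [mul_zero] at h3
        refine h3.congr fun j => ?_
        simp only [Function.comp, Nat.cast_add, Nat.cast_one, pow_succ ((2 : ℝ) ^ ε)]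
        have : (0 : ℝ) < (2 : ℝ) ^ ε := by positivity
        field_simp
      · exact mem_Ioi.2 (by positivity)
    refine h2.inv_tendsto_nhdsGT_zero.congr fun j => ?_
    simp
  have hpow : Tendsto (fun j : ℕ => (2 : ℝ) ^ j * L / 4) atTop atTop :=
    ((tendsto_pow_atTop_atTop_of_one_lt (by norm_num)).atTop_mul_const hL).atTop_div_const
      (by norm_num)
  obtain ⟨J, hJ⟩ := eventually_atTop.1
    ((hgrow.eventually_ge_atTop (8 / L)).and (hpow.eventually_ge_atTop 1))
  obtain ⟨j, hj, hcard⟩ := exists_card_primeBlock_ge (max J Q₀)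
  obtain ⟨h1, h2⟩ := hJ j (le_trans (le_max_left _ _) hj)
  refine ⟨2 ^ j, (le_trans (le_max_right _ _) hj).trans (Nat.lt_two_pow_self).le, ?_⟩
  have hfl : (2 : ℝ) ^ j * L / 8 ≤ (⌊((2 ^ j : ℕ) : ℝ) * L / 4⌋₊ : ℝ) := by
    push_cast
    have h3 := Nat.lt_floor_add_one ((2 : ℝ) ^ j * L / 4)
    have h4 : (1 : ℝ) ≤ ⌊(2 : ℝ) ^ j * L / 4⌋₊ := by exact_mod_cast Nat.le_floor (by simpa using h2)
    linarith
  refine le_trans ?_ (mul_le_mul hcard hfl (by positivity) (by positivity))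
  have h5 : (((2 ^ j : ℕ) : ℝ)) ^ (2 - ε) = (2 : ℝ) ^ j * (2 : ℝ) ^ j / ((2 : ℝ) ^ ε) ^ j := by
    push_cast
    rw [Real.rpow_sub (by positivity), ← Real.rpow_natCast ((2 : ℝ) ^ ε), ← Real.rpow_natCast,
      ← Real.rpow_mul (by norm_num), ← Real.rpow_mul (by norm_num), ← Real.rpow_mul (by norm_num),
      ← Real.rpow_add (by norm_num)]
    ring_nf
  rw [h5]
  have hE : (0 : ℝ) < ((2 : ℝ) ^ ε) ^ j := by positivity
  rw [div_le_div_iff₀ hL (by positivity)] at h1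
  rw [div_le_iff₀ hE]
  have hT : (0 : ℝ) < (2 : ℝ) ^ j := by positivity
  have hsq : (0 : ℝ) < ((j : ℝ) + 1) ^ 2 := by positivity
  have : (2 : ℝ) ^ j / ((j : ℝ) + 1) ^ 2 * ((2 : ℝ) ^ j * L / 8) * ((2 : ℝ) ^ ε) ^ j =
    (2 : ℝ) ^ j * (2 : ℝ) ^ j * ((((2 : ℝ) ^ ε) ^ j * L) / (8 * ((j : ℝ) + 1) ^ 2)) := by
    field_simp
  rw [this]
  refine le_mul_of_one_le_right (by positivity) ?_
  rw [one_le_div (by positivity)]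
  exact h1

end Primes

/-! ### Cantor construction with prime denominators -/

/-- The length of the intervals placed around fractions with denominator in `[Q, 2 * Q)`. -/
noncomputable def cantorLength (lam : ℝ) (Q : ℕ) : ℝ := (2 * (Q : ℝ)) ^ (-lam) / 2

/-- A sequence of denominator scales growing fast enough for the Cantor-type construction
below. -/
structure CantorScales (lam : ℝ) where
  /-- The scales. -/
  Q : ℕ → ℕ
  two_le : 2 ≤ lam
  zero : Q 0 = 1
  growth : ∀ k, 2 * Q k ≤ Q (k + 1)
  count : ∀ k : ℕ, (Q (k + 1) : ℝ) ^ (2 - 1 / ((k : ℝ) + 1)) ≤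
    (primeBlock (Q (k + 1))).card * ⌊(Q (k + 1) : ℝ) * cantorLength lam (Q k) / 4⌋₊

lemma cantorLength_pos {lam : ℝ} {Q : ℕ} (hQ : 1 ≤ Q) : 0 < cantorLength lam Q := by
  have : (0 : ℝ) < Q := by exact_mod_cast hQ
  unfold cantorLength
  positivity

lemma exists_cantorScales {lam : ℝ} (h : 2 ≤ lam) : Nonempty (CantorScales lam) := by
  have hstep : ∀ (k Q : ℕ), ∃ Q' : ℕ, 1 ≤ Q → (2 * Q ≤ Q' ∧
      (Q' : ℝ) ^ (2 - 1 / ((k : ℝ) + 1)) ≤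
        (primeBlock Q').card * ⌊(Q' : ℝ) * cantorLength lam Q / 4⌋₊) := by
    intro k Q
    by_cases hQ : 1 ≤ Q
    · obtain ⟨Q', h1, h2⟩ := exists_large_primeBlock (cantorLength_pos (lam := lam) hQ)
        (show (0 : ℝ) < 1 / ((k : ℝ) + 1) by positivity) (2 * Q)
      exact ⟨Q', fun _ => ⟨h1, h2⟩⟩
    · exact ⟨0, fun hc => absurd hc hQ⟩
  choose g hg using hstep
  let Q : ℕ → ℕ := fun k => Nat.rec 1 (fun k Q => g k Q) k
  have hpos : ∀ k, 1 ≤ Q k := by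
    intro k
    induction k with
    | zero => exact le_rfl
    | succ k ih => exact le_trans (by omega) (hg k (Q k) ih).1
  exact ⟨⟨Q, h, rfl, fun k => (hg k (Q k) (hpos k)).1, fun k => (hg k (Q k) (hpos k)).2⟩⟩

namespace CantorScales

variable {lam : ℝ} (S : CantorScales lam)

/-- The length of the intervals at level `k`. -/
noncomputable def len (k : ℕ) : ℝ := cantorLength lam (S.Q k)

/-- The number of fractions with a given denominator chosen in each interval of level `k`. -/
noncomputable def mult (k : ℕ) : ℕ := ⌊(S.Q (k + 1) : ℝ) * S.len k / 4⌋₊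

/-- The choices available when passing from level `k` to level `k + 1`. -/
abbrev Digit (k : ℕ) : Type := primeBlock (S.Q (k + 1)) × Fin (S.mult k)

/-- The left endpoint of the level `k` interval coded by `ω`. -/
noncomputable def point (ω : ∀ k, S.Digit k) : ℕ → ℝ
  -- Starting at `1 / 4`, with first length at most `1 / 8`, keeps all points in `(0, 1)`, so later
  -- numerators are prime to their denominators.
  | 0 => 1 / 4
  | k + 1 => ((⌈point ω k * ((ω k).1.1 : ℝ)⌉ + ((ω k).2.1 : ℤ) : ℤ) : ℝ) / ((ω k).1.1 : ℝ)

lemma two_pow_le_Q (k : ℕ) : 2 ^ k ≤ S.Q k := by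
  induction k with
  | zero => simp [S.zero]
  | succ k ih => exact le_trans (by rw [pow_succ]; omega) (S.growth k)

lemma one_le_Q (k : ℕ) : 1 ≤ S.Q k := Nat.one_le_two_pow.trans (S.two_pow_le_Q k)

lemma Q_pos (k : ℕ) : (0 : ℝ) < S.Q k := by exact_mod_cast S.one_le_Q k

lemma tendsto_Q : Tendsto (fun k => (S.Q k : ℝ)) atTop atTop :=
  tendsto_natCast_atTop_atTop.comp
    (tendsto_atTop_mono S.two_pow_le_Q (tendsto_pow_atTop_atTop_of_one_lt (by norm_num)))

lemma len_pos (k : ℕ) : 0 < S.len k := cantorLength_pos (S.one_le_Q k)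

lemma len_succ_le (k : ℕ) : S.len (k + 1) ≤ S.len k / 2 := by
  have hQ := S.Q_pos k
  have h1 : 2 * (S.Q k : ℝ) ≤ S.Q (k + 1) := by exact_mod_cast S.growth k
  have h2 : (2 * (S.Q (k + 1) : ℝ)) ^ (-lam) ≤ (2 * (2 * (S.Q k : ℝ))) ^ (-lam) :=
    Real.rpow_le_rpow_of_nonpos (by positivity) (by linarith) (by linarith [S.two_le])
  have h3 : (2 : ℝ) ^ (-lam) ≤ 1 / 2 := by
    calc (2 : ℝ) ^ (-lam) ≤ (2 : ℝ) ^ (-1 : ℝ) :=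
          Real.rpow_le_rpow_of_exponent_le (by norm_num) (by linarith [S.two_le])
      _ = 1 / 2 := by rw [Real.rpow_neg_one]; norm_num
  rw [Real.mul_rpow (y := 2 * (S.Q k : ℝ)) (by norm_num) (by positivity)] at h2
  have h4 : (0 : ℝ) < (2 * (S.Q k : ℝ)) ^ (-lam) := by positivity
  unfold len cantorLength
  nlinarith

lemma len_le_half_sq (k : ℕ) : S.len k ≤ 1 / (2 * (2 * (S.Q k : ℝ)) ^ 2) := by
  have hQ : (1 : ℝ) ≤ S.Q k := by exact_mod_cast S.one_le_Q k
  have h1 : (2 * (S.Q k : ℝ)) ^ (-lam) ≤ (2 * (S.Q k : ℝ)) ^ (-2 : ℝ) :=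
    Real.rpow_le_rpow_of_exponent_le (by linarith) (by linarith [S.two_le])
  rw [Real.rpow_neg (by positivity) 2, Real.rpow_two] at h1
  unfold len cantorLength
  rw [one_div, mul_inv]
  linarith

lemma len_zero_le : S.len 0 ≤ 1 / 8 := by
  have := S.len_le_half_sq 0
  rw [S.zero] at this
  norm_num at this ⊢
  linarith

lemma tendsto_len : Tendsto S.len atTop (𝓝 0) := by
  have h : ∀ k, S.len k ≤ (1 / 2 : ℝ) ^ k := by
    intro k
    induction k with
    | zero => have := S.len_zero_le; simp; linarith
    | succ k ih => have := S.len_succ_le k; rw [pow_succ]; linarith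
  exact squeeze_zero (fun k => (S.len_pos k).le) h
    (tendsto_pow_atTop_nhds_zero_of_lt_one (by norm_num) (by norm_num))

section Points

variable {S} (ω : ∀ k, S.Digit k)

lemma digit_prime (k : ℕ) : (ω k).1.1.Prime := (Finset.mem_filter.1 (ω k).1.2).2

lemma Q_le_digit (k : ℕ) : (S.Q (k + 1) : ℝ) ≤ ((ω k).1.1 : ℝ) := by
  exact_mod_cast (Finset.mem_Ico.1 (Finset.mem_filter.1 (ω k).1.2).1).1

lemma digit_lt (k : ℕ) : ((ω k).1.1 : ℝ) < 2 * S.Q (k + 1) := by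
  exact_mod_cast (Finset.mem_Ico.1 (Finset.mem_filter.1 (ω k).1.2).1).2

lemma digit_pos (k : ℕ) : (0 : ℝ) < ((ω k).1.1 : ℝ) := (S.Q_pos _).trans_le (Q_le_digit ω k)

lemma point_le_succ (k : ℕ) : S.point ω k ≤ S.point ω (k + 1) := by
  have hq := digit_pos ω k
  rw [point, le_div_iff₀ hq]
  have := Int.le_ceil (S.point ω k * ((ω k).1.1 : ℝ))
  push_cast
  linarith [Nat.cast_nonneg (α := ℝ) (ω k).2.1]

lemma point_succ_le (k : ℕ) : S.point ω (k + 1) ≤ S.point ω k + S.len k / 4 := by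
  have hq := digit_pos ω k
  rw [point, div_le_iff₀ hq]
  have h1 := Int.ceil_lt_add_one (S.point ω k * ((ω k).1.1 : ℝ))
  have h2 : ((ω k).2.1 : ℝ) + 1 ≤ S.mult k := by exact_mod_cast (ω k).2.2
  have h3 : (S.mult k : ℝ) ≤ (S.Q (k + 1) : ℝ) * S.len k / 4 :=
    Nat.floor_le (by have := S.len_pos k; positivity)
  have h4 := mul_le_mul_of_nonneg_right (Q_le_digit ω k) (S.len_pos k).le
  push_cast
  linarith

lemma point_mono : Monotone (S.point ω) := monotone_nat_of_le_succ (point_le_succ ω)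

/-- A child starts in the first quarter of its parent and is at most half as long, so the intervals
are nested. -/
lemma point_add_len_anti : Antitone fun k => S.point ω k + S.len k :=
  antitone_nat_of_succ_le fun k => by
    have := point_succ_le ω k
    have := S.len_succ_le k
    have := S.len_pos k
    linarith

lemma point_le_point_add_len (k l : ℕ) : S.point ω l ≤ S.point ω k + S.len k := by
  rcases le_total k l with h | h
  · have := point_add_len_anti ω h
    have h2 := S.len_pos l
    simp only at this
    linarith
  · have := point_mono ω h
    have h2 := S.len_pos k
    linarith

lemma point_pos (k : ℕ) : 0 < S.point ω k :=
  lt_of_lt_of_le (by norm_num [point]) (point_mono ω (Nat.zero_le k))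

lemma point_lt_one (k : ℕ) : S.point ω k < 1 := by
  have := point_le_point_add_len ω 0 k
  have h2 := S.len_zero_le
  have h3 : S.point ω 0 = 1 / 4 := rfl
  linarith

/-- The point coded by `ω`. -/
noncomputable def limitPoint (S : CantorScales lam) (ω : ∀ k, S.Digit k) : ℝ := ⨆ k, S.point ω k

lemma bddAbove_point : BddAbove (Set.range (S.point ω)) :=
  ⟨_, by rintro _ ⟨l, rfl⟩; exact point_le_point_add_len ω 0 l⟩

lemma point_le_limitPoint (k : ℕ) : S.point ω k ≤ S.limitPoint ω := le_ciSup (bddAbove_point ω) k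

lemma limitPoint_le (k : ℕ) : S.limitPoint ω ≤ S.point ω k + S.len k :=
  ciSup_le fun l => point_le_point_add_len ω k l

lemma tendsto_point : Tendsto (S.point ω) atTop (𝓝 (S.limitPoint ω)) :=
  tendsto_atTop_ciSup (point_mono ω) (bddAbove_point ω)

/-- The numerator of the fraction `point ω (k + 1)`. -/
noncomputable def numer (ω : ∀ k, S.Digit k) (k : ℕ) : ℤ :=
  ⌈S.point ω k * ((ω k).1.1 : ℝ)⌉ + ((ω k).2.1 : ℤ)

lemma point_succ (k : ℕ) : S.point ω (k + 1) = (numer ω k : ℝ) / ((ω k).1.1 : ℝ) := rfl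

lemma numer_pos (k : ℕ) : 0 < numer ω k := by
  have := point_pos ω (k + 1)
  rw [point_succ, lt_div_iff₀ (digit_pos ω k), zero_mul] at this
  exact_mod_cast this

lemma numer_lt (k : ℕ) : numer ω k < ((ω k).1.1 : ℤ) := by
  have := point_lt_one ω (k + 1)
  rw [point_succ, div_lt_one (digit_pos ω k)] at this
  exact_mod_cast this

variable {ω} {ω' : ∀ k, S.Digit k}

/-- Distinct fractions with denominators below `2 * Q` differ by more than `1 / (2 * Q) ^ 2`; at
level `0` there is only one point. -/
lemma inv_sq_lt_of_point_ne {k : ℕ} (h : S.point ω k ≠ S.point ω' k) :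
    1 / (2 * (S.Q k : ℝ)) ^ 2 < |S.point ω k - S.point ω' k| := by
  cases k with
  | zero => exact absurd rfl h
  | succ k =>
    have hq := digit_pos ω k
    have hq' := digit_pos ω' k
    have hlt := digit_lt ω k
    have hlt' := digit_lt ω' k
    have heq : S.point ω (k + 1) - S.point ω' (k + 1) =
        ((numer ω k * ((ω' k).1.1 : ℤ) - numer ω' k * ((ω k).1.1 : ℤ) : ℤ) : ℝ) /
          (((ω k).1.1 : ℝ) * ((ω' k).1.1 : ℝ)) := by
      rw [point_succ, point_succ, div_sub_div _ _ hq.ne' hq'.ne']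
      push_cast; ring
    have hne : numer ω k * ((ω' k).1.1 : ℤ) - numer ω' k * ((ω k).1.1 : ℤ) ≠ 0 := by
      intro h0
      rw [h0] at heq
      simp at heq
      exact h (by linarith)
    have h1 : (1 : ℝ) ≤
        |((numer ω k * ((ω' k).1.1 : ℤ) - numer ω' k * ((ω k).1.1 : ℤ) : ℤ) : ℝ)| := by
      exact_mod_cast Int.one_le_abs hne
    rw [heq, abs_div, abs_of_pos (mul_pos hq hq')]
    calc 1 / (2 * (S.Q (k + 1) : ℝ)) ^ 2
        < 1 / (((ω k).1.1 : ℝ) * ((ω' k).1.1 : ℝ)) := by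
          refine one_div_lt_one_div_of_lt (mul_pos hq hq') ?_
          rw [sq]
          exact mul_lt_mul'' hlt hlt' hq.le hq'.le
      _ ≤ _ := by gcongr

/-- Both fractions are reduced, since a prime cannot divide a smaller positive numerator. -/
lemma digit_eq_of_point_succ_eq {k : ℕ} (h : S.point ω (k + 1) = S.point ω' (k + 1)) :
    (ω k).1.1 = (ω' k).1.1 := by
  have hq := digit_pos ω k
  have hq' := digit_pos ω' k
  rw [point_succ, point_succ, div_eq_div_iff hq.ne' hq'.ne'] at h
  have h' : numer ω k * ((ω' k).1.1 : ℤ) = numer ω' k * ((ω k).1.1 : ℤ) := by exact_mod_cast h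
  have hp := digit_prime ω k
  have hp' := digit_prime ω' k
  have hdvd : ((ω k).1.1 : ℤ) ∣ numer ω k * ((ω' k).1.1 : ℤ) := ⟨numer ω' k, by rw [h']; ring⟩
  rcases (Nat.prime_iff_prime_int.1 hp).dvd_or_dvd hdvd with hd | hd
  · exact absurd (Int.le_of_dvd (numer_pos ω k) hd) (not_le.2 (numer_lt ω k))
  · exact (Nat.prime_dvd_prime_iff_eq hp hp').1 (Int.natCast_dvd_natCast.1 hd)

/-- Two parents of one child would be within `len k` of each other, less than the separation at
level `k`. -/
lemma point_eq_of_point_succ_eq {k : ℕ} (h : S.point ω (k + 1) = S.point ω' (k + 1)) :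
    S.point ω k = S.point ω' k := by
  by_contra hne
  have h1 := inv_sq_lt_of_point_ne hne
  have h2 := S.len_le_half_sq k
  have h3 := point_le_succ ω k
  have h4 := point_le_succ ω' k
  have h5 := point_succ_le ω k
  have h6 := point_succ_le ω' k
  have h7 := S.len_pos k
  have h8 : |S.point ω k - S.point ω' k| ≤ S.len k := by
    rw [abs_le]; constructor <;> linarith
  have h9 : 1 / (2 * (2 * (S.Q k : ℝ)) ^ 2) ≤ 1 / (2 * (S.Q k : ℝ)) ^ 2 := by
    have := S.Q_pos k
    exact one_div_le_one_div_of_le (by positivity) (by nlinarith [sq_nonneg (2 * (S.Q k : ℝ))])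
  linarith

lemma digits_eq_of_point_eq {k : ℕ} (h : S.point ω k = S.point ω' k) :
    ∀ i < k, ω i = ω' i := by
  induction k with
  | zero => intro i hi; omega
  | succ k ih =>
    have hk := point_eq_of_point_succ_eq h
    intro i hi
    rcases Nat.lt_succ_iff_lt_or_eq.1 hi with hi | rfl
    · exact ih hk i hi
    · have hd := digit_eq_of_point_succ_eq h
      refine Prod.ext (Subtype.ext hd) (Fin.ext ?_)
      rw [point_succ, point_succ, hd, div_left_inj' (digit_pos ω' i).ne'] at h
      have h' : numer ω i = numer ω' i := by exact_mod_cast h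
      unfold numer at h'
      rw [hk, hd] at h'
      omega

lemma abs_sub_lt_of_floor_eq {a b D : ℝ} (hD : 0 < D) (h : ⌊a * D⌋ = ⌊b * D⌋) :
    |a - b| < 1 / D := by
  have := Int.abs_sub_lt_one_of_floor_eq_floor h
  rw [← sub_mul, abs_mul, abs_of_pos hD] at this
  rwa [lt_div_iff₀ hD]

lemma point_eq_of_floor_eq {k : ℕ}
    (h : ⌊S.point ω k * (2 * (S.Q k : ℝ)) ^ 2⌋ = ⌊S.point ω' k * (2 * (S.Q k : ℝ)) ^ 2⌋) :
    S.point ω k = S.point ω' k := by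
  by_contra hne
  have := S.Q_pos k
  exact (inv_sq_lt_of_point_ne hne).not_gt (abs_sub_lt_of_floor_eq (by positivity) h)

/-- For a fixed denominator `q < 2 * Q` the spacing is `1 / q`, so cells of size `1 / (2 * Q)`
already separate the points, instead of `1 / (2 * Q) ^ 2`. -/
lemma point_eq_of_digit_eq_of_floor_eq {k : ℕ} (hd : (ω k).1 = (ω' k).1)
    (h : ⌊S.point ω (k + 1) * (2 * (S.Q (k + 1) : ℝ))⌋ =
      ⌊S.point ω' (k + 1) * (2 * (S.Q (k + 1) : ℝ))⌋) :
    S.point ω (k + 1) = S.point ω' (k + 1) := by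
  have hQ := S.Q_pos (k + 1)
  have h1 := abs_sub_lt_of_floor_eq (by positivity) h
  have hq := digit_pos ω' k
  have hlt := digit_lt ω' k
  rw [point_succ, point_succ, hd, ← sub_div, abs_div, abs_of_pos hq, div_lt_iff₀ hq] at h1
  have h2 : |(numer ω k : ℝ) - numer ω' k| < 1 := by
    refine h1.trans_le ?_
    rw [one_div, inv_mul_le_iff₀ (by positivity)]
    linarith
  have h3 : |numer ω k - numer ω' k| < 1 := by exact_mod_cast h2
  have h4 : numer ω k = numer ω' k := by
    have := Int.abs_lt_one_iff.1 h3; omega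
  rw [point_succ, point_succ, hd, h4]

end Points

end CantorScales

/-! ### The uniform measure on the Cantor set and its ball estimates -/

namespace CantorScales

variable {lam : ℝ} (S : CantorScales lam)

lemma card_mul_mult_pos (k : ℕ) : 0 < (primeBlock (S.Q (k + 1))).card * S.mult k := by
  have h := S.count k
  have h2 : (0 : ℝ) < (S.Q (k + 1) : ℝ) ^ (2 - 1 / ((k : ℝ) + 1)) :=
    Real.rpow_pos_of_pos (S.Q_pos _) _
  exact_mod_cast h2.trans_le h

lemma card_digit (k : ℕ) :
    Fintype.card (S.Digit k) = (primeBlock (S.Q (k + 1))).card * S.mult k := by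
  simp [Digit]

instance (k : ℕ) : Nonempty (S.Digit k) :=
  Fintype.card_pos_iff.1 (by rw [card_digit]; exact S.card_mul_mult_pos k)

/-- The uniform measure on the sequences of digits. -/
noncomputable def digitMeasure : Measure (∀ k, S.Digit k) :=
  Measure.infinitePi fun k => ProbabilityTheory.uniformOn (Set.univ : Set (S.Digit k))

instance (k : ℕ) :
    IsProbabilityMeasure (ProbabilityTheory.uniformOn (Set.univ : Set (S.Digit k))) :=
  ProbabilityTheory.isProbabilityMeasure_uniformOn Set.finite_univ Set.univ_nonempty

instance : IsProbabilityMeasure S.digitMeasure := by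
  unfold digitMeasure; infer_instance

/-- The number of intervals of level `k`. -/
noncomputable def total (k : ℕ) : ℕ := ∏ i ∈ Finset.range k, Fintype.card (S.Digit i)

lemma total_pos (k : ℕ) : 0 < S.total k := Finset.prod_pos fun _ _ => Fintype.card_pos

lemma total_succ (k : ℕ) :
    S.total (k + 1) = S.total k * ((primeBlock (S.Q (k + 1))).card * S.mult k) := by
  rw [total, Finset.prod_range_succ, card_digit]; rfl

lemma rpow_le_total_succ (k : ℕ) :
    (S.Q (k + 1) : ℝ) ^ (2 - 1 / ((k : ℝ) + 1)) ≤ S.total (k + 1) := by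
  refine (S.count k).trans ?_
  rw [total_succ]
  exact_mod_cast Nat.le_mul_of_pos_left _ (S.total_pos k)

lemma digitMeasure_cylinder (w : ∀ k, S.Digit k) (k : ℕ) :
    S.digitMeasure {ω | ∀ i < k, ω i = w i} = (S.total k : ℝ≥0∞)⁻¹ := by
  have h1 : {ω : ∀ k, S.Digit k | ∀ i < k, ω i = w i} =
      ((Finset.range k : Finset ℕ) : Set ℕ).pi fun i => {w i} := by
    ext ω; simp [Set.mem_pi]
  rw [h1, digitMeasure, Measure.infinitePi_pi _ fun i _ => measurableSet_singleton _, total,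
    Nat.cast_prod, ENNReal.prod_inv_distrib]
  · refine Finset.prod_congr rfl fun i _ => ?_
    rw [ProbabilityTheory.uniformOn_univ, Measure.count_singleton, one_div]
  · intro i _ j _ _
    exact Or.inr (ENNReal.natCast_ne_top _)

/-- Each fibre of `Φ` lies in a cylinder of mass `1 / total k`, so it suffices to count the keys
that occur. -/
lemma digitMeasure_le_card_div {β : Type*} (k : ℕ) (E : Set (∀ k, S.Digit k))
    (Φ : (∀ k, S.Digit k) → β) (T : Finset β) (hT : ∀ ω ∈ E, Φ ω ∈ T)
    (hΦ : ∀ ω ω', Φ ω = Φ ω' → ∀ i < k, ω i = ω' i) :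
    S.digitMeasure E ≤ ENNReal.ofReal ((T.card : ℝ) / S.total k) := by
  have hcov : E ⊆ ⋃ t ∈ T, {ω | Φ ω = t} := fun ω hω =>
    mem_iUnion₂.2 ⟨Φ ω, hT ω hω, rfl⟩
  have hone : ∀ t ∈ T, S.digitMeasure {ω | Φ ω = t} ≤ (S.total k : ℝ≥0∞)⁻¹ := by
    intro t _
    rcases Set.eq_empty_or_nonempty {ω | Φ ω = t} with he | ⟨w, hw⟩
    · rw [he]; simp
    · rw [← S.digitMeasure_cylinder w k]
      exact measure_mono fun ω hω => hΦ ω w (Eq.trans hω (Eq.symm hw))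
  have hpos : (0 : ℝ) < S.total k := by exact_mod_cast S.total_pos k
  calc S.digitMeasure E ≤ ∑ t ∈ T, S.digitMeasure {ω | Φ ω = t} :=
        (measure_mono hcov).trans (measure_biUnion_finset_le _ _)
    _ ≤ ∑ t ∈ T, (S.total k : ℝ≥0∞)⁻¹ := Finset.sum_le_sum hone
    _ = _ := by
      rw [Finset.sum_const, nsmul_eq_mul, ENNReal.ofReal_div_of_pos hpos, ENNReal.ofReal_natCast,
        ENNReal.ofReal_natCast, div_eq_mul_inv]

lemma measurable_point (k : ℕ) : Measurable fun ω => S.point ω k := by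
  induction k with
  | zero => exact measurable_const
  | succ k ih =>
    have h : Measurable fun z : ℝ × S.Digit k =>
        ((⌈z.1 * (z.2.1.1 : ℝ)⌉ + (z.2.2.1 : ℤ) : ℤ) : ℝ) / (z.2.1.1 : ℝ) := by
      refine measurable_from_prod_countable_left fun d => ?_
      have : Measurable fun x : ℝ => ⌈x * (d.1.1 : ℝ)⌉ :=
        Int.measurable_ceil.comp (measurable_id.mul_const _)
      exact (measurable_from_top (f := fun z : ℤ => ((z + (d.2.1 : ℤ) : ℤ) : ℝ) /
        (d.1.1 : ℝ))).comp this
    have hk : Measurable fun ω : ∀ k, S.Digit k => ω k := measurable_pi_apply k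
    have hpair : Measurable fun ω : ∀ k, S.Digit k => (S.point ω k, ω k) := ih.prodMk hk
    simpa only [point, Function.comp_def] using h.comp hpair

lemma measurable_limitPoint : Measurable S.limitPoint :=
  measurable_of_tendsto_metrizable S.measurable_point
    (tendsto_pi_nhds.2 fun ω => tendsto_point ω)

/-- The distribution of the limit point. -/
noncomputable def law : Measure ℝ := S.digitMeasure.map S.limitPoint

instance : IsProbabilityMeasure S.law :=
  Measure.isProbabilityMeasure_map S.measurable_limitPoint.aemeasurable

/-- The left endpoint lies below the limit point by at most `len k ≤ r`, hence the extra `r` on the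
left. -/
lemma law_closedBall_le (x r : ℝ) (k : ℕ) (hr : S.len k ≤ r) :
    S.law (Metric.closedBall x r) ≤ S.digitMeasure {ω | S.point ω k ∈ Icc (x - 2 * r) (x + r)} := by
  rw [law, Measure.map_apply S.measurable_limitPoint Metric.isClosed_closedBall.measurableSet]
  refine measure_mono fun ω hω => ?_
  have h1 : S.limitPoint ω ∈ Icc (x - r) (x + r) := by
    rw [← Real.closedBall_eq_Icc]; exact hω
  have h2 := point_le_limitPoint ω k
  have h3 := limitPoint_le ω k
  exact ⟨by linarith [h1.1], by linarith [h1.2]⟩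

lemma card_Icc_floor_le {a b D : ℝ} (hD : 0 ≤ D) (hab : a ≤ b) :
    ((Finset.Icc ⌊a * D⌋ ⌊b * D⌋).card : ℝ) ≤ (b - a) * D + 2 := by
  have h : ⌊a * D⌋ ≤ ⌊b * D⌋ := Int.floor_mono (by gcongr)
  rw [Int.card_Icc, ← Int.cast_natCast, Int.toNat_of_nonneg (by linarith)]
  push_cast
  have h1 := Int.floor_le (b * D)
  have h2 := Int.lt_floor_add_one (a * D)
  linarith

lemma floor_mem_Icc {a b c D : ℝ} (hD : 0 ≤ D) (h : c ∈ Icc a b) :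
    ⌊c * D⌋ ∈ Finset.Icc ⌊a * D⌋ ⌊b * D⌋ :=
  Finset.mem_Icc.2 ⟨Int.floor_mono (mul_le_mul_of_nonneg_right h.1 hD),
    Int.floor_mono (mul_le_mul_of_nonneg_right h.2 hD)⟩

lemma law_closedBall_le_of_separated (x : ℝ) {r : ℝ} (k : ℕ) (hr0 : 0 ≤ r) (hr : S.len k ≤ r) :
    S.law (Metric.closedBall x r) ≤
      ENNReal.ofReal ((3 * r * (2 * (S.Q k : ℝ)) ^ 2 + 2) / S.total k) := by
  refine (S.law_closedBall_le x r k hr).trans ?_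
  set D : ℝ := (2 * (S.Q k : ℝ)) ^ 2 with hD
  refine (S.digitMeasure_le_card_div k _ (fun ω => ⌊S.point ω k * D⌋)
    (Finset.Icc ⌊(x - 2 * r) * D⌋ ⌊(x + r) * D⌋)
    (fun ω hω => floor_mem_Icc (by positivity) hω)
    fun ω ω' h => digits_eq_of_point_eq (point_eq_of_floor_eq h)).trans ?_
  refine ENNReal.ofReal_le_ofReal ?_
  gcongr
  refine (card_Icc_floor_le (by positivity) (by linarith)).trans_eq ?_
  ring

lemma law_closedBall_le_of_equidistributed (x : ℝ) {r : ℝ} (k : ℕ) (hr0 : 0 ≤ r)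
    (hr : S.len (k + 1) ≤ r) :
    S.law (Metric.closedBall x r) ≤ ENNReal.ofReal
      ((primeBlock (S.Q (k + 1))).card * (3 * r * (2 * (S.Q (k + 1) : ℝ)) + 2) /
        S.total (k + 1)) := by
  refine (S.law_closedBall_le x r (k + 1) hr).trans ?_
  set D : ℝ := 2 * (S.Q (k + 1) : ℝ) with hD
  refine (S.digitMeasure_le_card_div (k + 1) _
    (fun ω => ((ω k).1, ⌊S.point ω (k + 1) * D⌋))
    (Finset.univ ×ˢ Finset.Icc ⌊(x - 2 * r) * D⌋ ⌊(x + r) * D⌋)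
    (fun ω hω => Finset.mem_product.2 ⟨Finset.mem_univ _, floor_mem_Icc (by positivity) hω⟩)
    fun ω ω' h => digits_eq_of_point_eq (point_eq_of_digit_eq_of_floor_eq
      (Prod.ext_iff.1 h).1 (Prod.ext_iff.1 h).2)).trans ?_
  refine ENNReal.ofReal_le_ofReal ?_
  rw [Finset.card_product, Finset.card_univ, Fintype.card_coe, Nat.cast_mul]
  gcongr
  refine (card_Icc_floor_le (by positivity) (by linarith)).trans_eq ?_
  ring

/-- The left side is a constant times `Q ^ (lam * s)` with `lam * s < 2`, while `total` is at least
`Q ^ (2 - o(1))`. -/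
lemma eventually_len_rpow_le_total {s : ℝ} (hs : s < 2 / lam) :
    ∀ᶠ k in atTop, S.len k ^ (-s) ≤ S.total k := by
  have hlam : 0 < lam := by linarith [S.two_le]
  have hgap : 0 < 2 - lam * s := by
    rw [lt_div_iff₀ hlam] at hs; linarith
  -- Half of the gap absorbs the constant, the other half the loss `1 / (k + 1)`.
  set g := (2 - lam * s) / 2 with hg
  have hg0 : 0 < g := by positivity
  have h1 : ∀ᶠ k : ℕ in atTop, (2 : ℝ) ^ (lam * s + s) ≤ (S.Q k : ℝ) ^ g :=
    ((tendsto_rpow_atTop hg0).comp S.tendsto_Q).eventually_ge_atTop _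
  have h2 : ∀ᶠ k : ℕ in atTop, 1 / ((k : ℝ) + 1) ≤ g :=
    (tendsto_one_div_add_atTop_nhds_zero_nat (𝕜 := ℝ)).eventually_le_const hg0
  rw [← map_add_atTop_eq_nat 1, eventually_map]
  filter_upwards [(tendsto_add_atTop_nat 1).eventually h1, h2] with k hk1 hk2
  refine le_trans ?_ (S.rpow_le_total_succ k)
  have hQ := S.Q_pos (k + 1)
  have hQ1 : (1 : ℝ) ≤ S.Q (k + 1) := by exact_mod_cast S.one_le_Q (k + 1)
  have h3 : S.len (k + 1) ^ (-s) = (2 : ℝ) ^ (lam * s + s) * (S.Q (k + 1) : ℝ) ^ (lam * s) := by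
    unfold len cantorLength
    rw [div_eq_mul_inv, Real.mul_rpow (by positivity) (by positivity), ← Real.rpow_mul (by positivity),
      Real.inv_rpow (by norm_num), ← Real.rpow_neg (by norm_num),
      Real.mul_rpow (by norm_num) (by positivity), Real.rpow_add (by norm_num)]
    ring_nf
  rw [h3]
  calc _ ≤ (S.Q (k + 1) : ℝ) ^ g * (S.Q (k + 1) : ℝ) ^ (lam * s) := by gcongr
    _ = (S.Q (k + 1) : ℝ) ^ (g + lam * s) := (Real.rpow_add hQ _ _).symm
    _ ≤ _ := Real.rpow_le_rpow_of_exponent_le hQ1 (by linarith)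

lemma len_mul_Q_le_mult (k : ℕ) : S.Q (k + 1) * S.len k / 8 ≤ S.mult k := by
  have h1 : 1 ≤ S.mult k := Nat.pos_of_mul_pos_left (S.card_mul_mult_pos k)
  have h2 := Nat.lt_floor_add_one ((S.Q (k + 1) : ℝ) * S.len k / 4)
  have h3 : (1 : ℝ) ≤ S.mult k := by exact_mod_cast h1
  change _ < (S.mult k : ℝ) + 1 at h2
  linarith

lemma exists_len_le_lt {k₀ : ℕ} {r : ℝ} (hr0 : 0 < r) (hr : r < S.len k₀) :
    ∃ k ≥ k₀, S.len (k + 1) ≤ r ∧ r < S.len k := by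
  classical
  have hex : ∃ j, S.len (k₀ + j) ≤ r := by
    obtain ⟨k, hk1, hk2⟩ := ((S.tendsto_len.eventually_le_const hr0).and
      (eventually_ge_atTop k₀)).exists
    exact ⟨k - k₀, by rwa [Nat.add_sub_cancel' hk2]⟩
  have hspec := Nat.find_spec hex
  have hne : Nat.find hex ≠ 0 := by
    intro h0
    rw [h0] at hspec
    exact absurd hspec (not_le.2 hr)
  obtain ⟨j, hj⟩ := Nat.exists_eq_succ_of_ne_zero hne
  refine ⟨k₀ + j, Nat.le_add_right _ _, ?_, ?_⟩
  · rw [hj] at hspec; exact hspec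
  · exact not_le.1 (Nat.find_min hex (by omega))

/-- The distribution of the limit point has every Frostman exponent below `2 / lam`. -/
lemma law_isFrostman {s : ℝ} (hs0 : 0 ≤ s) (hs : s < 2 / lam) : ∃ C, IsFrostman S.law C s := by
  have hlam : 0 < lam := by linarith [S.two_le]
  have hs1 : s < 1 := hs.trans_le (by rw [div_le_one hlam]; exact S.two_le)
  have h2 : ∀ᶠ k : ℕ in atTop, 1 / ((k : ℝ) + 1) ≤ 1 - s :=
    (tendsto_one_div_add_atTop_nhds_zero_nat (𝕜 := ℝ)).eventually_le_const (by linarith)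
  obtain ⟨k₀, hk₀⟩ := eventually_atTop.1 ((S.eventually_len_rpow_le_total hs).and h2)
  have hL0 := S.len_pos k₀
  refine ⟨max 64 (S.len k₀ ^ (-s)), fun x r hr0 => ?_⟩
  have hrs : 0 < r ^ s := Real.rpow_pos_of_pos hr0 s
  rcases le_or_gt (S.len k₀) r with hr | hr
  · refine prob_le_one.trans ?_
    rw [← ENNReal.ofReal_one]
    refine ENNReal.ofReal_le_ofReal ?_
    calc (1 : ℝ) = S.len k₀ ^ (-s) * S.len k₀ ^ s := by
          rw [← Real.rpow_add hL0]; simp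
      _ ≤ max 64 (S.len k₀ ^ (-s)) * r ^ s := by
          gcongr
          exact le_max_right _ _
  suffices h : S.law (Metric.closedBall x r) ≤ ENNReal.ofReal (64 * r ^ s) from
    h.trans (ENNReal.ofReal_le_ofReal (by gcongr; exact le_max_left _ _))
  obtain ⟨k, hkk, hk1, hk2⟩ := S.exists_len_le_lt hr0 hr
  have hQ := S.Q_pos (k + 1)
  have hT : (0 : ℝ) < S.total (k + 1) := by exact_mod_cast S.total_pos (k + 1)
  -- Below the spacing `1 / Q` the separation of all fractions is used; above it, each denominator
  -- contributes at most `6 * r * Q + 2 ≤ 8 * r * Q` points.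
  rcases lt_or_ge r (1 / (S.Q (k + 1) : ℝ)) with hrQ | hrQ
  · refine (S.law_closedBall_le_of_separated x (k + 1) hr0.le hk1).trans
      (ENNReal.ofReal_le_ofReal ?_)
    have hA : 2 ≤ 2 * r ^ s * S.total (k + 1) := by
      have h3 := (hk₀ (k + 1) (by omega)).1
      have h4 : r ^ (-s) ≤ S.len (k + 1) ^ (-s) :=
        Real.rpow_le_rpow_of_nonpos (S.len_pos _) hk1 (by linarith)
      have h5 : r ^ s * r ^ (-s) = 1 := by rw [← Real.rpow_add hr0]; simp
      have h6 := mul_le_mul_of_nonneg_left (h4.trans h3) hrs.le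
      linarith
    -- The missing factor `Q ^ e` is at most `r ^ (-e)` because `r < 1 / Q`, and `1 - e ≥ s`.
    have hB : r * (S.Q (k + 1) : ℝ) ^ 2 ≤ r ^ s * S.total (k + 1) := by
      have h3 := S.rpow_le_total_succ k
      have h4 := (hk₀ k hkk).2
      set e : ℝ := 1 / ((k : ℝ) + 1) with he
      have he0 : 0 < e := by positivity
      have h5 : (S.Q (k + 1) : ℝ) ^ 2 = (S.Q (k + 1) : ℝ) ^ (2 - e) * (S.Q (k + 1) : ℝ) ^ e := by
        rw [← Real.rpow_add hQ, sub_add_cancel, Real.rpow_two]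
      have h6 : (S.Q (k + 1) : ℝ) ^ e ≤ r ^ (-e) := by
        rw [Real.rpow_neg hr0.le, ← Real.inv_rpow hr0.le]
        refine Real.rpow_le_rpow hQ.le ?_ he0.le
        rw [lt_div_iff₀ hQ] at hrQ
        rw [← one_div, le_div_iff₀ hr0]
        linarith
      have hr1 : r ≤ 1 := by
        refine hrQ.le.trans ?_
        rw [div_le_one hQ]
        exact_mod_cast S.one_le_Q (k + 1)
      have h7 : r * r ^ (-e) ≤ r ^ s := by
        nth_rewrite 1 [← Real.rpow_one r]
        rw [← Real.rpow_add hr0]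
        exact Real.rpow_le_rpow_of_exponent_ge hr0 hr1 (by linarith)
      calc r * (S.Q (k + 1) : ℝ) ^ 2
          = (r * (S.Q (k + 1) : ℝ) ^ e) * (S.Q (k + 1) : ℝ) ^ (2 - e) := by rw [h5]; ring
        _ ≤ (r * r ^ (-e)) * S.total (k + 1) := by gcongr
        _ ≤ _ := by gcongr
    rw [div_le_iff₀ hT]
    nlinarith
  · refine (S.law_closedBall_le_of_equidistributed x k hr0.le hk1).trans
      (ENNReal.ofReal_le_ofReal ?_)
    rw [div_le_iff₀ hQ] at hrQ
    have hlen := S.len_pos k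
    have hT' : (0 : ℝ) < S.total k := by exact_mod_cast S.total_pos k
    have h3 := (hk₀ k hkk).1
    have h4 := S.len_mul_Q_le_mult k
    -- The mass is at most `64 * r / (len k * total k)`, with one `8` from the count and one from
    -- `len_mul_Q_le_mult`; `len k ^ (-s) ≤ total k` and `r < len k` finish.
    have h5 : r ≤ r ^ s * S.len k ^ (1 - s) := by
      calc r = r ^ s * r ^ (1 - s) := by rw [← Real.rpow_add hr0]; simp
        _ ≤ _ := by
          gcongr
    have h6 : S.len k ^ (1 - s) ≤ S.len k * S.total k := by
      rw [sub_eq_add_neg, Real.rpow_add hlen, Real.rpow_one]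
      gcongr
    have h7 : r ≤ r ^ s * (S.len k * S.total k) := h5.trans (by gcongr)
    rw [div_le_iff₀ hT, total_succ]
    push_cast
    calc (primeBlock (S.Q (k + 1))).card * (3 * r * (2 * (S.Q (k + 1) : ℝ)) + 2)
        ≤ (primeBlock (S.Q (k + 1))).card * (8 * (S.Q (k + 1) : ℝ) * r) := by
          gcongr; linarith
      _ ≤ (primeBlock (S.Q (k + 1))).card *
          (8 * (S.Q (k + 1) : ℝ) * (r ^ s * (S.len k * S.total k))) := by gcongr
      _ = (primeBlock (S.Q (k + 1))).card * (64 * r ^ s * S.total k) *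
          (S.Q (k + 1) * S.len k / 8) := by ring
      _ ≤ (primeBlock (S.Q (k + 1))).card * (64 * r ^ s * S.total k) * S.mult k := by gcongr
      _ = _ := by ring

/-! ### The measure is carried by exponent exactly `lam` -/

lemma infinite_goodApprox_limitPoint {ω : ∀ k, S.Digit k} (h : Irrational (S.limitPoint ω)) :
    (goodApprox (S.limitPoint ω) lam).Infinite := by
  intro hfin
  set R : ℕ → ℚ := fun k => (numer ω k : ℚ) / ((ω k).1.1 : ℚ) with hR
  have hpt : ∀ k, (R k : ℝ) = S.point ω (k + 1) := by
    intro k; rw [point_succ, hR]; push_cast; rfl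
  have hmem : ∀ k, R k ∈ goodApprox (S.limitPoint ω) lam := by
    intro k
    have hq := digit_pos ω k
    have h1 := point_le_limitPoint ω (k + 1)
    have h2 := limitPoint_le ω (k + 1)
    have h3 : S.len (k + 1) ≤ (2 * (S.Q (k + 1) : ℝ)) ^ (-lam) := by
      unfold len cantorLength
      have := S.Q_pos (k + 1)
      have : (0 : ℝ) < (2 * (S.Q (k + 1) : ℝ)) ^ (-lam) := by positivity
      linarith
    have hden : ((R k).den : ℝ) ≤ 2 * S.Q (k + 1) := by
      refine le_trans ?_ (digit_lt ω k).le
      have hdvd : ((R k).den : ℤ) ∣ (((ω k).1.1 : ℕ) : ℤ) := by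
        have := Rat.den_dvd (numer ω k) ((ω k).1.1 : ℤ)
        rw [Rat.divInt_eq_div] at this
        simpa [hR] using this
      exact_mod_cast Nat.le_of_dvd (by exact_mod_cast hq) (Int.natCast_dvd_natCast.1 hdvd)
    change |S.limitPoint ω - (R k : ℝ)| ≤ _
    rw [hpt, abs_of_nonneg (by linarith)]
    calc _ ≤ (2 * (S.Q (k + 1) : ℝ)) ^ (-lam) := by linarith
      _ ≤ _ := Real.rpow_le_rpow_of_nonpos (lt_of_lt_of_le one_pos (one_le_den_cast _)) hden
        (by linarith [S.two_le])
  -- A finite set of approximations is closed and would contain the limit of the points, making it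
  -- rational.
  have hcl := (hfin.image ((↑) : ℚ → ℝ)).isClosed.mem_of_tendsto
    ((tendsto_point ω).comp (tendsto_add_atTop_nat 1))
    (Eventually.of_forall fun k => ⟨R k, hmem k, hpt k⟩)
  obtain ⟨r, -, hr⟩ := hcl
  exact h ⟨r, hr⟩

end CantorScales

lemma measurableSet_infinite_goodApprox {m : ℝ} (hm : 0 ≤ m) :
    MeasurableSet {x : ℝ | (goodApprox x m).Infinite} := by
  have h : {x : ℝ | (goodApprox x m).Infinite} =
      ⋂ N : ℕ, ⋃ r : ℚ, {x : ℝ | N < r.den ∧ |x - (r : ℝ)| ≤ (r.den : ℝ) ^ (-m)} := by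
    ext x
    simp only [mem_iInter, mem_iUnion, mem_ofPred_eq]
    constructor
    · intro hx N
      obtain ⟨r, hr, hN⟩ := exists_den_gt_of_infinite_goodApprox hm hx N
      exact ⟨r, hN, hr⟩
    · refine fun hx => infinite_of_forall_exists_den_gt fun N => ?_
      obtain ⟨r, hN, hr⟩ := hx N
      exact ⟨r, hr, hN⟩
  rw [h]
  refine MeasurableSet.iInter fun N => MeasurableSet.iUnion fun r =>
    (MeasurableSet.const _).inter ?_
  exact measurableSet_le (f := fun x : ℝ => |x - (r : ℝ)|) (by fun_prop) measurable_const

/-- For finite `lam ≥ 2` there is a probability measure carried by the numbers with irrationality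
exponent exactly `lam` which has every Frostman exponent below `2 / lam`. -/
theorem exists_frostman_measure_irrationalityExponent {lam : ℝ≥0} (hlam : 2 ≤ lam) :
    ∃ ν : Measure ℝ, IsProbabilityMeasure ν ∧ (∀ᵐ x ∂ν, irrationalityExponent x = lam) ∧
      ∀ s : ℝ, 0 ≤ s → s < 2 / lam → ∃ C, IsFrostman ν C s := by
  have hlam' : (2 : ℝ) ≤ lam := by exact_mod_cast hlam
  obtain ⟨S⟩ := exists_cantorScales hlam'
  have hF : ∀ s : ℝ, 0 ≤ s → s < 2 / lam → ∃ C, IsFrostman S.law C s :=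
    fun s hs0 hs => S.law_isFrostman hs0 hs
  refine ⟨S.law, inferInstance, ?_, hF⟩
  have hpos : (0 : ℝ) < 2 / lam := by positivity
  obtain ⟨C, hC⟩ := hF (2 / lam / 2) (by positivity) (by linarith)
  have hirr := hC.measure_rat_eq_zero (by positivity)
  have hinf : ∀ᵐ x ∂S.law, (goodApprox x lam).Infinite := by
    refine (ae_map_iff S.measurable_limitPoint.aemeasurable
      (measurableSet_infinite_goodApprox lam.2)).2 ?_
    filter_upwards [ae_of_ae_map S.measurable_limitPoint.aemeasurable hirr] with ω hω
    exact S.infinite_goodApprox_limitPoint hω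
  filter_upwards [ae_irrationalityExponent_le (by positivity) hF, hinf] with x h1 h2
  exact le_antisymm h1 (le_irrationalityExponent fun m hm =>
    h2.mono (goodApprox_anti (by exact_mod_cast hm.le)))

/-! ### Bounding the exponent from a sequence of approximants -/

lemma one_div_den_mul_den_le_abs_sub {r r' : ℚ} (h : r ≠ r') :
    1 / ((r.den : ℝ) * r'.den) ≤ |(r : ℝ) - r'| := by
  have hr := one_le_den_cast r
  have hr' := one_le_den_cast r'
  have hpos : (0 : ℝ) < (r.den : ℝ) * r'.den := by positivity
  have heq : ((r : ℝ) - r') * ((r.den : ℝ) * r'.den) =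
      ((r.num * r'.den - r'.num * r.den : ℤ) : ℝ) := by
    have h1 : (r.num : ℝ) = r * r.den := by exact_mod_cast (Rat.mul_den_eq_num r).symm
    have h2 : (r'.num : ℝ) = r' * r'.den := by exact_mod_cast (Rat.mul_den_eq_num r').symm
    push_cast
    rw [h1, h2]; ring
  have hne : r.num * r'.den - r'.num * r.den ≠ 0 := by
    intro h0
    rw [h0, Int.cast_zero, mul_eq_zero] at heq
    rcases heq with heq | heq
    · exact h (by exact_mod_cast sub_eq_zero.1 heq)
    · exact hpos.ne' heq
  rw [div_le_iff₀ hpos, ← abs_of_pos hpos, ← abs_mul, heq]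
  exact_mod_cast Int.one_le_abs hne

/-- If `x` has a sequence of approximations of exponent exactly `lam` whose denominators do not
grow too fast, then the irrationality exponent of `x` is controlled. -/
lemma finite_goodApprox_of_approximants {x m lam : ℝ} (hlam : 1 < lam) (hm : lam < m) (R : ℕ → ℚ)
    (hR : Tendsto (fun k => ((R k).den : ℝ)) atTop atTop)
    (hlow : ∀ᶠ k in atTop, ((R k).den : ℝ) ^ (-lam) / 2 ≤ |x - R k|)
    (hup : ∀ᶠ k in atTop, |x - R k| ≤ ((R k).den : ℝ) ^ (-lam))
    (hgap : ∀ᶠ k in atTop,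
      2 * ((R (k + 1)).den : ℝ) ≤ (((R k).den : ℝ) ^ (lam - 1) / 2) ^ (m - 1)) :
    (goodApprox x m).Finite := by
  classical
  have hbig : ∀ᶠ k in atTop, (2 : ℝ) < ((R k).den : ℝ) ^ (m - lam) :=
    ((tendsto_rpow_atTop (sub_pos.2 hm)).comp hR).eventually_gt_atTop 2
  have hD : Tendsto (fun k => ((R k).den : ℝ) ^ (lam - 1) / 2) atTop atTop :=
    ((tendsto_rpow_atTop (sub_pos.2 hlam)).comp hR).atTop_div_const (by norm_num)
  obtain ⟨K, hK⟩ := eventually_atTop.1 (hlow.and (hup.and (hgap.and hbig)))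
  refine finite_goodApprox_of_den_le (by linarith) ⌈((R K).den : ℝ) ^ (lam - 1) / 2⌉₊ ?_
  intro r hr
  by_contra! hlt
  have hb1 := one_le_den_cast r
  have hb0 : (0 : ℝ) < r.den := by linarith
  have hbK : ((R K).den : ℝ) ^ (lam - 1) / 2 < r.den := Nat.lt_of_ceil_lt hlt
  -- Take the first `k` with `r.den < (R k).den ^ (lam - 1) / 2`. Then `R k` is too close to `x` for
  -- `r` to be close as well, while minimality and `hgap` bound `r.den` below.
  have hex : ∃ j, (r.den : ℝ) < ((R (K + j)).den : ℝ) ^ (lam - 1) / 2 := by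
    obtain ⟨k, hk1, hk2⟩ := ((hD.eventually_gt_atTop (r.den : ℝ)).and
      (eventually_ge_atTop K)).exists
    exact ⟨k - K, by rwa [Nat.add_sub_cancel' hk2]⟩
  have hspec := Nat.find_spec hex
  have hne : Nat.find hex ≠ 0 := by
    intro h0
    rw [h0] at hspec
    exact absurd hspec (not_lt.2 hbK.le)
  obtain ⟨j, hj⟩ := Nat.exists_eq_succ_of_ne_zero hne
  have hprev := not_lt.1 (Nat.find_min hex (m := j) (by omega))
  rw [hj] at hspec
  have hgap' := (hK (K + j) (by omega)).2.2.1
  obtain ⟨hlow', hup', -, hbig'⟩ := hK (K + j + 1) (by omega)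
  change (r.den : ℝ) < ((R (K + j + 1)).den : ℝ) ^ (lam - 1) / 2 at hspec
  set k := K + j + 1
  have hq1 := one_le_den_cast (R k)
  have hq0 : (0 : ℝ) < (R k).den := by linarith
  have hr' : |x - (r : ℝ)| ≤ (r.den : ℝ) ^ (-m) := hr
  by_cases hrk : r = R k
  -- The lower bound `q ^ (-lam) / 2` exceeds `q ^ (-m)`, as `q ^ (m - lam) > 2`.
  · rw [hrk] at hr'
    have h1 : ((R k).den : ℝ) ^ (-lam) = ((R k).den : ℝ) ^ (-m) * ((R k).den : ℝ) ^ (m - lam) := by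
      rw [← Real.rpow_add hq0]; ring_nf
    have h2 : (0 : ℝ) < ((R k).den : ℝ) ^ (-m) := by positivity
    nlinarith
  · have h1 := one_div_den_mul_den_le_abs_sub hrk
    have h2 : (((R k).den : ℝ)) ^ (-lam) < 1 / (2 * ((r.den : ℝ) * (R k).den)) := by
      have h3 : (((R k).den : ℝ)) ^ (-lam) = 1 / ((R k).den * ((R k).den : ℝ) ^ (lam - 1)) := by
        rw [Real.rpow_neg hq0.le, ← one_div, Real.rpow_sub_one hq0.ne']
        field_simp
      rw [h3]
      refine one_div_lt_one_div_of_lt (by positivity) ?_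
      nlinarith
    have h4 : (r.den : ℝ) ^ (-m) ≤ 1 / (2 * ((r.den : ℝ) * (R k).den)) := by
      have h5 : 2 * ((R k).den : ℝ) ≤ (r.den : ℝ) ^ (m - 1) :=
        hgap'.trans (Real.rpow_le_rpow (by positivity) hprev (by linarith))
      rw [Real.rpow_neg hb0.le, ← one_div]
      refine one_div_le_one_div_of_le (by positivity) ?_
      rw [Real.rpow_sub_one hb0.ne', le_div_iff₀ hb0] at h5
      linarith
    have h5 : |(r : ℝ) - R k| ≤ |x - r| + |x - R k| := by
      rw [abs_sub_comm x r]
      exact abs_sub_le _ _ _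
    have h6 : 1 / ((r.den : ℝ) * (R k).den) = 2 * (1 / (2 * ((r.den : ℝ) * (R k).den))) := by
      field_simp
    linarith

/-! ### Translates with prescribed dyadic approximations -/

/-- The least odd integer that is at least `x`. -/
noncomputable def oddCeil (x : ℝ) : ℤ := 2 * ⌈(x - 1) / 2⌉ + 1

lemma le_oddCeil (x : ℝ) : x ≤ oddCeil x := by
  have := Int.le_ceil ((x - 1) / 2)
  unfold oddCeil; push_cast; linarith

lemma oddCeil_lt (x : ℝ) : (oddCeil x : ℝ) < x + 2 := by
  have := Int.ceil_lt_add_one ((x - 1) / 2)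
  unfold oddCeil; push_cast; linarith

lemma odd_oddCeil (x : ℝ) : Odd (oddCeil x) := ⟨_, rfl⟩

lemma den_odd_div_two_pow {p : ℤ} (hp : Odd p) (e : ℕ) :
    ((p : ℚ) / ((2 : ℚ) ^ e)).den = 2 ^ e := by
  have hc : p.natAbs.Coprime ((2 : ℤ) ^ e).natAbs := by
    rw [Int.natAbs_pow]
    exact Nat.Coprime.pow_right e ((Nat.coprime_two_right).2 (Int.natAbs_odd.2 hp))
  have := Rat.den_div_eq_of_coprime (a := p) (b := (2 : ℤ) ^ e) (by positivity) hc
  push_cast at this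
  exact_mod_cast this

/-- Given shifts `y k`, exponents `ex k` and rapidly growing dyadic denominators `2 ^ e k`, there is
a `t` such that each `y k + t` is approximated with exponent exactly `ex k` by a dyadic rational of
denominator `2 ^ e k`. -/
lemma exists_translate_dyadic (y ex : ℕ → ℝ) (e : ℕ → ℕ) (hex : ∀ k, 1 ≤ ex k)
    (he : ∀ k, ex k * e k + 3 ≤ e (k + 1)) :
    ∃ t : ℝ, ∀ k, ∃ p : ℤ, Odd p ∧
      ((2 : ℝ) ^ e k) ^ (-ex k) / 2 ≤ y k + t - p / 2 ^ e k ∧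
      y k + t - p / 2 ^ e k ≤ ((2 : ℝ) ^ e k) ^ (-ex k) := by
  -- Step `k` moves up to the next odd dyadic point, then half the target distance past it. The
  -- remaining drift is at most `4 / 2 ^ e (k + 1)`, which fits in the other half.
  let a : ℕ → ℝ := fun k => Nat.rec 0 (fun k a =>
    (oddCeil ((a + y k) * 2 ^ e k) : ℝ) / 2 ^ e k - y k + ((2 : ℝ) ^ e k) ^ (-ex k) / 2) k
  have ha : ∀ k, a (k + 1) = (oddCeil ((a k + y k) * 2 ^ e k) : ℝ) / 2 ^ e k - y k +
    ((2 : ℝ) ^ e k) ^ (-ex k) / 2 := fun k => rfl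
  have hlo : ∀ k, a k + y k ≤ (oddCeil ((a k + y k) * 2 ^ e k) : ℝ) / 2 ^ e k := by
    intro k
    rw [le_div_iff₀ (by positivity)]
    exact le_oddCeil _
  have hhi : ∀ k, (oddCeil ((a k + y k) * 2 ^ e k) : ℝ) / 2 ^ e k ≤ a k + y k + 2 / 2 ^ e k := by
    intro k
    have := oddCeil_lt ((a k + y k) * 2 ^ e k)
    rw [div_le_iff₀ (by positivity), add_mul (a k + y k), div_mul_cancel₀ _ (by positivity)]
    exact this.le
  have hpos : ∀ k, 0 < ((2 : ℝ) ^ e k) ^ (-ex k) := fun k => by positivity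
  have hinv : ∀ k, ((2 : ℝ) ^ e k) ^ (-ex k) ≤ 1 / 2 ^ e k := by
    intro k
    rw [one_div, ← Real.rpow_neg_one]
    exact Real.rpow_le_rpow_of_exponent_le (one_le_pow₀ (by norm_num)) (by linarith [hex k])
  -- The `3` in `he` pays for the factor `8 = 4 * 2` here.
  have hnext : ∀ k, 4 / (2 : ℝ) ^ e (k + 1) ≤ ((2 : ℝ) ^ e k) ^ (-ex k) / 2 := by
    intro k
    have h1 : ((2 : ℝ) ^ e k) ^ (-ex k) = (2 : ℝ) ^ (-(ex k * e k)) := by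
      rw [← Real.rpow_natCast, ← Real.rpow_mul (by norm_num)]; ring_nf
    have h2 : 4 / (2 : ℝ) ^ e (k + 1) = (2 : ℝ) ^ (2 - (e (k + 1) : ℝ)) := by
      rw [Real.rpow_sub (by norm_num), Real.rpow_natCast]; norm_num
    have h3 : ((2 : ℝ) ^ (-(ex k * e k))) / 2 = (2 : ℝ) ^ (-(ex k * e k) - 1) := by
      rw [Real.rpow_sub_one (by norm_num)]
    rw [h1, h2, h3]
    exact Real.rpow_le_rpow_of_exponent_le (by norm_num) (by linarith [he k])
  have hmono : Monotone a := monotone_nat_of_le_succ fun k => by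
    rw [ha]; linarith [hlo k, hpos k]
  have hanti : Antitone fun k => a k + 4 / (2 : ℝ) ^ e k := antitone_nat_of_succ_le fun k => by
    have h1 := hnext k
    have h2 := hhi k
    have h3 := hinv k
    have h4 : (2 : ℝ) / 2 ^ e k = 2 * (1 / 2 ^ e k) := by ring
    have h5 : (4 : ℝ) / 2 ^ e k = 4 * (1 / 2 ^ e k) := by ring
    have h6 : (0 : ℝ) < 1 / 2 ^ e k := by positivity
    rw [ha, h5]
    linarith
  have hle : ∀ k l, a l ≤ a k + 4 / (2 : ℝ) ^ e k := by
    intro k l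
    have h0 : ∀ j, (0 : ℝ) < 4 / (2 : ℝ) ^ e j := fun j => by positivity
    rcases le_total k l with h | h
    · have := hanti h
      simp only at this
      linarith [h0 l]
    · linarith [hmono h, h0 k]
  have hbdd : BddAbove (Set.range a) := ⟨_, by rintro _ ⟨l, rfl⟩; exact hle 0 l⟩
  refine ⟨⨆ k, a k, fun k => ⟨_, odd_oddCeil ((a k + y k) * 2 ^ e k), ?_, ?_⟩⟩
  · have h1 := le_ciSup hbdd (k + 1)
    rw [ha] at h1
    linarith
  · have h1 : ⨆ k, a k ≤ a (k + 1) + 4 / (2 : ℝ) ^ e (k + 1) := ciSup_le fun l => hle (k + 1) l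
    rw [ha] at h1
    linarith [hnext k]

/-! ### Cyclic visits: every diagonal line meets the product -/

section Cyclic

variable {n : ℕ} [NeZero n]

/-- The exponent used at step `k`: the coordinates are visited cyclically, and infinite exponents
are approximated by finite ones. -/
noncomputable def stepExponent (lam : Fin n → ℝ≥0∞) (k : ℕ) : ℝ :=
  (min (lam (Fin.ofNat n k)) ((k : ℝ≥0∞) + 2)).toReal

/-- The binary logarithm of the denominator used at step `k`. -/
noncomputable def stepLog (lam : Fin n → ℝ≥0∞) : ℕ → ℕ
  | 0 => 1
  | k + 1 => ⌈stepExponent lam k * stepLog lam k⌉₊ + 3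

variable {lam : Fin n → ℝ≥0∞}

lemma stepExponent_ne_top (lam : Fin n → ℝ≥0∞) (k : ℕ) :
    min (lam (Fin.ofNat n k)) ((k : ℝ≥0∞) + 2) ≠ ∞ :=
  ((min_le_right _ _).trans_lt (by finiteness)).ne

lemma two_le_stepExponent (hlam : ∀ i, 2 ≤ lam i) (k : ℕ) : 2 ≤ stepExponent lam k := by
  have h : ((2 : ℝ≥0∞)).toReal ≤ stepExponent lam k :=
    ENNReal.toReal_mono (stepExponent_ne_top lam k) (le_min (hlam _) le_add_self)
  simpa using h

lemma stepLog_succ_ge (lam : Fin n → ℝ≥0∞) (k : ℕ) :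
    stepExponent lam k * stepLog lam k + 3 ≤ stepLog lam (k + 1) := by
  have := Nat.le_ceil (stepExponent lam k * stepLog lam k)
  rw [stepLog]; push_cast; linarith

lemma stepLog_succ_le (lam : Fin n → ℝ≥0∞) (k : ℕ) :
    (stepLog lam (k + 1) : ℝ) ≤ stepExponent lam k * stepLog lam k + 4 := by
  have := Nat.ceil_lt_add_one (a := stepExponent lam k * stepLog lam k)
    (mul_nonneg ENNReal.toReal_nonneg (Nat.cast_nonneg _))
  rw [stepLog]; push_cast; linarith

lemma stepLog_strictMono (hlam : ∀ i, 2 ≤ lam i) : StrictMono (stepLog lam) := by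
  refine strictMono_nat_of_lt_succ fun k => ?_
  have h1 := stepLog_succ_ge lam k
  have h2 := two_le_stepExponent hlam k
  have h3 : (stepLog lam k : ℝ) < stepLog lam (k + 1) := by
    nlinarith [Nat.cast_nonneg (α := ℝ) (stepLog lam k)]
  exact_mod_cast h3

lemma eventually_stepExponent_eq (hfin : ∀ i, lam i ≠ ∞) :
    ∀ᶠ k in atTop, stepExponent lam k = (lam (Fin.ofNat n k)).toReal := by
  have h : ∀ i, ∀ᶠ k : ℕ in atTop, lam i ≤ (k : ℝ≥0∞) + 2 := by
    intro i
    obtain ⟨N, hN⟩ := ENNReal.exists_nat_gt (hfin i)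
    filter_upwards [eventually_ge_atTop N] with k hk
    exact hN.le.trans ((Nat.cast_le.2 hk).trans le_self_add)
  filter_upwards [eventually_all.2 h] with k hk
  rw [stepExponent, min_eq_left (hk _)]

lemma prod_cyclic (f : Fin n → ℝ) (k : ℕ) :
    ∏ l ∈ Finset.range n, f (Fin.ofNat n (k + l)) = ∏ i, f i := by
  rw [Finset.prod_range fun l => f (Fin.ofNat n (k + l)),
    ← Equiv.prod_comp (Equiv.addLeft (Fin.ofNat n k)) f]
  refine Finset.prod_congr rfl fun l _ => congrArg f (Fin.ext ?_)
  simp [Fin.val_add]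

/-- Each step multiplies the logarithm by the current exponent and adds at most `4`; as exponents
are at least `1`, each `4` grows by at most the full product over a turn. -/
lemma eventually_stepLog_add_le (hlam : ∀ i, 2 ≤ lam i) (hfin : ∀ i, lam i ≠ ∞) :
    ∀ᶠ k in atTop, (stepLog lam (k + n) : ℝ) ≤ (∏ i, (lam i).toReal) * (stepLog lam k + 4 * n) := by
  obtain ⟨K, hK⟩ := eventually_atTop.1 (eventually_stepExponent_eq hfin)
  filter_upwards [eventually_ge_atTop K] with k hk
  have hone : ∀ i, 1 ≤ (lam i).toReal := fun i => by
    have := ENNReal.toReal_mono (hfin i) (hlam i)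
    simp only [ENNReal.toReal_ofNat] at this
    linarith
  suffices h : ∀ j : ℕ, (stepLog lam (k + j) : ℝ) ≤
      (∏ l ∈ Finset.range j, (lam (Fin.ofNat n (k + l))).toReal) * (stepLog lam k + 4 * j) by
    have := h n
    rwa [prod_cyclic (fun i => (lam i).toReal)] at this
  intro j
  induction j with
  | zero => simp
  | succ j ih =>
    have h1 := stepLog_succ_le lam (k + j)
    rw [hK (k + j) (by omega)] at h1
    rw [← add_assoc, Finset.prod_range_succ]
    set P := ∏ l ∈ Finset.range j, (lam (Fin.ofNat n (k + l))).toReal with hP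
    have hP1 : 1 ≤ P := by
      rw [hP, ← Finset.prod_const_one (s := Finset.range j)]
      exact Finset.prod_le_prod (fun _ _ => zero_le_one) fun _ _ => hone _
    set c := (lam (Fin.ofNat n (k + j))).toReal
    have hc : 1 ≤ c := hone _
    have h2 : c * stepLog lam (k + j) ≤ c * (P * (stepLog lam k + 4 * j)) := by gcongr
    have h3 : 1 ≤ P * c := by nlinarith
    push_cast
    nlinarith

/-- Every line in direction `(1, …, 1)` meets the product of the sets of numbers with prescribed
irrationality exponents. -/
theorem exists_translate_mem_exponentLevelSet {mu : Fin n → ℝ≥0∞} (hlam : ∀ i, 2 ≤ lam i)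
    (hle : ∀ i, lam i ≤ mu i) (hmu : ∀ i, mu i = ∞ ∨ (∏ j, lam j) / (lam i - 1) + 1 < mu i)
    (y : Fin n → ℝ) : ∃ t : ℝ, ∀ i, y i + t ∈ exponentLevelSet (lam i) (mu i) := by
  obtain ⟨t, ht⟩ := exists_translate_dyadic (fun k => y (Fin.ofNat n k)) (stepExponent lam)
    (stepLog lam) (fun k => by linarith [two_le_stepExponent hlam k]) (stepLog_succ_ge lam)
  choose p hodd hlow hup using ht
  let R : ℕ → ℚ := fun k => (p k : ℚ) / ((2 : ℚ) ^ stepLog lam k)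
  have hden : ∀ k, (R k).den = 2 ^ stepLog lam k := fun k => den_odd_div_two_pow (hodd k) _
  have hden' : ∀ k, ((R k).den : ℝ) = 2 ^ stepLog lam k := fun k => by
    rw [hden]; push_cast; rfl
  have hcast : ∀ k, (R k : ℝ) = p k / 2 ^ stepLog lam k := fun k => by simp [R]
  have hlow' : ∀ k, ((R k).den : ℝ) ^ (-stepExponent lam k) / 2 ≤ |y (Fin.ofNat n k) + t - R k| := by
    intro k
    rw [hden', hcast]
    exact (hlow k).trans (le_abs_self _)
  have hup' : ∀ k, |y (Fin.ofNat n k) + t - R k| ≤ ((R k).den : ℝ) ^ (-stepExponent lam k) := by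
    intro k
    have h0 : (0 : ℝ) < ((2 : ℝ) ^ stepLog lam k) ^ (-stepExponent lam k) := by positivity
    rw [hden', hcast, abs_of_nonneg (by linarith [hlow k])]
    exact hup k
  have hlog : Tendsto (stepLog lam) atTop atTop := (stepLog_strictMono hlam).tendsto_atTop
  have hdenlim : Tendsto (fun k => ((R k).den : ℝ)) atTop atTop := by
    simp only [hden']
    exact (tendsto_pow_atTop_atTop_of_one_lt (by norm_num)).comp hlog
  refine ⟨t, fun i => ?_⟩
  -- The indices `i + n * j` are the visits to coordinate `i`.
  have hsub : Tendsto (fun j : ℕ => i.val + n * j) atTop atTop :=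
    tendsto_atTop_mono (fun j => (Nat.le_mul_of_pos_left j (Nat.pos_of_neZero n)).trans
      (Nat.le_add_left _ _)) tendsto_id
  have hidx : ∀ j : ℕ, (Fin.ofNat n (i.val + n * j)) = i := by
    intro j
    refine Fin.ext ?_
    simp [Nat.mod_eq_of_lt i.2]
  constructor
  · refine le_irrationalityExponent fun m hm => infinite_of_forall_exists_den_gt fun N => ?_
    obtain ⟨N', hN'⟩ := exists_nat_gt (m : ℝ)
    have h1 : ∀ᶠ k in atTop, (N : ℝ) < (R k).den := hdenlim.eventually_gt_atTop _
    obtain ⟨j, hj1, hj2⟩ := ((hsub.eventually h1).and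
      (hsub.eventually (eventually_ge_atTop N'))).exists
    refine ⟨R (i.val + n * j), ?_, by exact_mod_cast hj1⟩
    have h2 := hup' (i.val + n * j)
    rw [hidx] at h2
    refine goodApprox_anti ?_ h2
    have h3 : (m : ℝ≥0∞).toReal ≤ stepExponent lam (i.val + n * j) := by
      refine ENNReal.toReal_mono (stepExponent_ne_top lam _) (le_min ?_ ?_)
      · rw [hidx]; exact hm.le
      · refine le_trans ?_ le_self_add
        have h4 : m ≤ ((i.val + n * j : ℕ) : ℝ≥0) := by
          have h5 : (m : ℝ) ≤ ((i.val + n * j : ℕ) : ℝ) := hN'.le.trans (by exact_mod_cast hj2)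
          exact_mod_cast h5
        exact_mod_cast h4
    simpa using h3
  · rcases hmu i with htop | hmui
    · rw [htop]; exact le_top
    refine irrationalityExponent_le fun m hm => ?_
    -- Since `∞ / ∞ = 0` in `ℝ≥0∞`, `hmui` says little when `lam i = ∞`; finiteness comes from `lam
    -- i ≤ mu i < m`. An infinite product over a finite `lam i - 1` then contradicts `hmui`.
    have hlami : lam i ≠ ∞ := (((hle i).trans_lt hm).trans ENNReal.coe_lt_top).ne
    have hprod : ∏ j, lam j ≠ ∞ := by
      intro h
      rw [h, ENNReal.top_div_of_ne_top (by finiteness)] at hmui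
      simp at hmui
    have hfin : ∀ j, lam j ≠ ∞ := by
      intro j hj
      refine hprod ?_
      rw [← Finset.mul_prod_erase _ _ (Finset.mem_univ j), hj]
      refine ENNReal.top_mul (Finset.prod_ne_zero_iff.2 fun l _ => ?_)
      exact (lt_of_lt_of_le two_pos (hlam l)).ne'
    have hlamr : 2 ≤ (lam i).toReal := by
      simpa using ENNReal.toReal_mono hlami (hlam i)
    have hmr : (lam i).toReal < m := by
      simpa using ENNReal.toReal_strict_mono ENNReal.coe_ne_top ((hle i).trans_lt hm)
    have hkey : ∏ j, (lam j).toReal < ((lam i).toReal - 1) * ((m : ℝ) - 1) := by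
      have h1 := ENNReal.toReal_strict_mono ENNReal.coe_ne_top (hmui.trans hm)
      rw [ENNReal.toReal_add (ne_top_of_lt (le_self_add.trans_lt hmui)) ENNReal.one_ne_top,
        ENNReal.toReal_div, ENNReal.toReal_sub_of_le (le_trans (by norm_num) (hlam i)) hlami,
        ENNReal.toReal_prod, ENNReal.toReal_one, ENNReal.coe_toReal, ← lt_sub_iff_add_lt,
        div_lt_iff₀ (by linarith)] at h1
      linarith
    have hexp : ∀ᶠ j : ℕ in atTop, stepExponent lam (i.val + n * j) = (lam i).toReal := by
      filter_upwards [hsub.eventually (eventually_stepExponent_eq hfin)] with j hj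
      rw [hj, hidx]
    refine finite_goodApprox_of_approximants (lam := (lam i).toReal) (by linarith) hmr
      (fun j => R (i.val + n * j)) (hdenlim.comp hsub) ?_ ?_ ?_
    · filter_upwards [hexp] with j hj
      have := hlow' (i.val + n * j)
      rwa [hj, hidx] at this
    · filter_upwards [hexp] with j hj
      have := hup' (i.val + n * j)
      rwa [hj, hidx] at this
    · set Λ := ∏ j, (lam j).toReal
      set l := (lam i).toReal
      -- In binary logarithms the gap condition follows from `Λ * (e + 4 * n) + 1 ≤ ((l - 1) * e -
      -- 1) * (m - 1)`, which holds for large `e` by `hkey`.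
      have hlim : Tendsto (fun k => ((l - 1) * ((m : ℝ) - 1) - Λ) * (stepLog lam k : ℝ))
          atTop atTop :=
        (tendsto_natCast_atTop_atTop.comp hlog).const_mul_atTop (by linarith)
      filter_upwards [hsub.eventually (eventually_stepLog_add_le hlam hfin),
        hsub.eventually (hlim.eventually_ge_atTop (Λ * (4 * n) + 1 + ((m : ℝ) - 1)))] with j hj1 hj2
      have hidx' : i.val + n * (j + 1) = i.val + n * j + n := by ring
      rw [hidx', hden', hden']
      set e := stepLog lam (i.val + n * j)
      set e' := stepLog lam (i.val + n * j + n)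
      have h1 : 2 * (2 : ℝ) ^ e' = (2 : ℝ) ^ ((e' : ℝ) + 1) := by
        rw [Real.rpow_add_one (by norm_num), Real.rpow_natCast]; ring
      have h2 : (((2 : ℝ) ^ e) ^ (l - 1) / 2) ^ ((m : ℝ) - 1) =
          (2 : ℝ) ^ (((e : ℝ) * (l - 1) - 1) * ((m : ℝ) - 1)) := by
        rw [Real.rpow_mul (by norm_num), Real.rpow_sub_one (x := 2) (by norm_num),
          Real.rpow_mul (by norm_num), Real.rpow_natCast]
      rw [h1, h2]
      refine Real.rpow_le_rpow_of_exponent_le (by norm_num) ?_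
      nlinarith

end Cyclic

/-! ### Product measures, projection, and the theorem -/

lemma IsFrostman.pi {ι : Type*} [Fintype ι] {ν : ι → Measure ℝ}
    [∀ i, IsProbabilityMeasure (ν i)] {C s : ι → ℝ} (h : ∀ i, IsFrostman (ν i) (C i) (s i)) :
    IsFrostman (Measure.pi ν) (∏ i, max (C i) 0) (∑ i, s i) := by
  intro x r hr
  rw [closedBall_pi x hr.le, Measure.pi_pi, Real.rpow_sum_of_pos hr, ← Finset.prod_mul_distrib,
    ENNReal.ofReal_prod_of_nonneg fun i _ => by positivity]
  refine Finset.prod_le_prod' fun i _ => (h i (x i) r hr).trans (ENNReal.ofReal_le_ofReal ?_)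
  gcongr
  exact le_max_left _ _

/-- For every `lam ∈ [2, ∞]` there is a probability measure carried by the numbers with
irrationality exponent exactly `lam` which has every Frostman exponent `θ * (2 / lam)`,
`θ < 1`. -/
lemma exists_frostman_measure {lam : ℝ≥0∞} (hlam : 2 ≤ lam) :
    ∃ ν : Measure ℝ, IsProbabilityMeasure ν ∧ (∀ᵐ x ∂ν, irrationalityExponent x = lam) ∧
      ∀ θ : ℝ, 0 ≤ θ → θ < 1 → ∃ C, IsFrostman ν C (θ * (2 / lam).toReal) := by
  rcases eq_or_ne lam ∞ with rfl | hfin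
  · obtain ⟨t, ht⟩ := exists_translate_mem_exponentLevelSet (n := 1) (lam := fun _ => ∞)
      (mu := fun _ => ∞) (fun _ => le_top) (fun _ => le_rfl) (fun _ => Or.inl rfl) 0
    refine ⟨Measure.dirac t, inferInstance, ?_, fun θ _ _ => ⟨1, fun x r _ => ?_⟩⟩
    · rw [ae_dirac_eq]
      have := (ht 0).1
      simpa using this
    · simpa using prob_le_one (μ := Measure.dirac t) (s := Metric.closedBall x r)
  · lift lam to ℝ≥0 using hfin
    have hlam' : 2 ≤ lam := by exact_mod_cast hlam
    obtain ⟨ν, h1, h2, h3⟩ := exists_frostman_measure_irrationalityExponent hlam'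
    refine ⟨ν, h1, h2, fun θ h0 h1 => ?_⟩
    have hpos : (0 : ℝ) < 2 / lam := by
      have : (0 : ℝ) < lam := by exact_mod_cast lt_of_lt_of_le two_pos hlam'
      positivity
    have heq : ((2 : ℝ≥0∞) / lam).toReal = 2 / (lam : ℝ) := by
      simp [ENNReal.toReal_div]
    rw [heq]
    exact h3 _ (by positivity) (by nlinarith)

/-- The product measure gives the set full mass and is Frostman with exponent `θ` times the bound
for each `θ < 1`, so the set has nonzero measure in that dimension; let `θ` tend to `1`. -/
lemma two_mul_sum_inv_le_dimH {ι : Type*} [Fintype ι] {lam mu : ι → ℝ≥0∞}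
    (hlam : ∀ i, 2 ≤ lam i) (hle : ∀ i, lam i ≤ mu i) :
    2 * ∑ i, (lam i)⁻¹ ≤ dimH {x : ι → ℝ | ∀ i, x i ∈ exponentLevelSet (lam i) (mu i)} := by
  set E := {x : ι → ℝ | ∀ i, x i ∈ exponentLevelSet (lam i) (mu i)}
  choose ν hprob hae hfr using fun i => exists_frostman_measure (hlam i)
  have hmem : ∀ᵐ x ∂(Measure.pi ν), x ∈ E := by
    refine eventually_all.2 fun i => ?_
    have := Measure.tendsto_eval_ae_ae (μ := ν) (i := i) |>.eventually (hae i)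
    filter_upwards [this] with x hx
    have hx' : irrationalityExponent (x i) = lam i := hx
    exact ⟨hx'.ge, hx'.trans_le (hle i)⟩
  have hfin : ∀ i, 2 / lam i ≠ ∞ := fun i =>
    ENNReal.div_ne_top (by norm_num) (lt_of_lt_of_le two_pos (hlam i)).ne'
  have hsum : 2 * ∑ i, (lam i)⁻¹ = ∑ i, 2 / lam i := by
    rw [Finset.mul_sum]; rfl
  have key : ∀ θ : ℝ≥0, θ < 1 → (θ : ℝ≥0∞) * (2 * ∑ i, (lam i)⁻¹) ≤ dimH E := by
    intro θ hθ
    choose C hC using fun i => hfr i θ θ.2 (by exact_mod_cast hθ)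
    have hF := IsFrostman.pi hC
    set d : ℝ≥0 := ∑ i, θ * (2 / lam i).toNNReal with hd
    have hd' : ∑ i, (θ : ℝ) * (2 / lam i).toReal = d := by
      rw [hd]; push_cast; rfl
    have hd'' : (θ : ℝ≥0∞) * (2 * ∑ i, (lam i)⁻¹) = d := by
      rw [hsum, Finset.mul_sum, hd]
      push_cast
      exact Finset.sum_congr rfl fun i _ => by rw [ENNReal.coe_toNNReal (hfin i)]
    rw [hd'] at hF
    rw [hd'']
    refine le_dimH_of_hausdorffMeasure_ne_zero fun h0 => ?_
    have h1 := hF.measure_eq_zero d.2 h0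
    have h2 : Measure.pi ν Eᶜ = 0 := hmem
    have h3 : Measure.pi ν univ ≤ 0 := by
      rw [← union_compl_self E]
      exact (measure_union_le _ _).trans (by rw [h1, h2, add_zero])
    rw [measure_univ] at h3
    exact absurd h3 (by norm_num)
  have hlim : Tendsto (fun θ : ℝ≥0 => (θ : ℝ≥0∞) * (2 * ∑ i, (lam i)⁻¹)) (𝓝[<] 1)
      (𝓝 (2 * ∑ i, (lam i)⁻¹)) := by
    have h1 : Tendsto (fun θ : ℝ≥0 => (θ : ℝ≥0∞)) (𝓝[<] 1) (𝓝 1) :=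
      (ENNReal.tendsto_coe.2 tendsto_id).mono_left nhdsWithin_le_nhds
    simpa using ENNReal.Tendsto.mul_const h1 (Or.inl one_ne_zero)
  have : (𝓝[<] (1 : ℝ≥0)).NeBot := nhdsLT_neBot_of_exists_lt ⟨0, one_pos⟩
  exact le_of_tendsto hlim (eventually_mem_nhdsWithin.mono fun θ hθ => key θ hθ)

lemma natCast_le_dimH {n : ℕ} {lam mu : Fin (n + 1) → ℝ≥0∞} (hlam : ∀ i, 2 ≤ lam i)
    (hle : ∀ i, lam i ≤ mu i) (hmu : ∀ i, mu i = ∞ ∨ (∏ j, lam j) / (lam i - 1) + 1 < mu i) :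
    (n : ℝ≥0∞) ≤ dimH {x : Fin (n + 1) → ℝ | ∀ i, x i ∈ exponentLevelSet (lam i) (mu i)} := by
  set E := {x : Fin (n + 1) → ℝ | ∀ i, x i ∈ exponentLevelSet (lam i) (mu i)}
  let T : (Fin (n + 1) → ℝ) →L[ℝ] (Fin n → ℝ) := ContinuousLinearMap.pi fun i =>
    ContinuousLinearMap.proj (R := ℝ) (φ := fun _ : Fin (n + 1) => ℝ) i.succ -
      ContinuousLinearMap.proj (R := ℝ) (φ := fun _ : Fin (n + 1) => ℝ) 0
  have hT : T '' E = univ := by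
    refine eq_univ_of_forall fun z => ?_
    -- The fibre of `T` over `z` is the diagonal line through `(0, z)`.
    obtain ⟨t, ht⟩ := exists_translate_mem_exponentLevelSet hlam hle hmu
      (Fin.cons 0 z : Fin (n + 1) → ℝ)
    refine ⟨fun i => (Fin.cons 0 z : Fin (n + 1) → ℝ) i + t, ht, ?_⟩
    ext i
    simp [T]
  have h := T.lipschitz.dimH_image_le E
  rw [hT, Real.dimH_univ_pi, Fintype.card_fin] at h
  exact h

theorem mainTheorem3 (n : ℕ) (hn : 1 ≤ n) (lam mu : Fin n → ℝ≥0∞)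
    (hlam : ∀ i, 2 ≤ lam i) (hle : ∀ i, lam i ≤ mu i)
    (hmu : ∀ i, mu i = ∞ ∨ (∏ j, lam j) / (lam i - 1) + 1 < mu i) :
    dimH (exponentLevelProduct lam mu) ≤ ((n : ℝ≥0∞) - 1) + 2 / (⨆ i, lam i) ∧
      max ((n : ℝ≥0∞) - 1) (2 * ∑ i, (lam i)⁻¹) ≤ dimH (exponentLevelProduct lam mu) := by
  obtain ⟨n, rfl⟩ := Nat.exists_eq_add_of_le' hn
  -- The linear identification with the sup-norm space preserves Hausdorff dimension.
  have himage : EuclideanSpace.equiv (Fin (n + 1)) ℝ '' exponentLevelProduct lam mu =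
      {x : Fin (n + 1) → ℝ | ∀ i, x i ∈ exponentLevelSet (lam i) (mu i)} := by
    ext x
    constructor
    · rintro ⟨z, hz, rfl⟩
      exact hz
    · intro hx
      exact ⟨WithLp.toLp 2 x, hx, rfl⟩
  have hdim := (EuclideanSpace.equiv (Fin (n + 1)) ℝ).dimH_image (exponentLevelProduct lam mu)
  rw [himage] at hdim
  rw [← hdim]
  refine ⟨?_, max_le ?_ (two_mul_sum_inv_le_dimH hlam hle)⟩
  · obtain ⟨i, hi⟩ := exists_eq_ciSup_of_finite (f := lam)
    rw [← hi]
    have h := dimH_le_of_le_irrationalityExponent i (lt_of_lt_of_le two_pos (hlam i))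
    rw [Fintype.card_fin] at h
    exact (dimH_mono fun x hx => (hx i).1).trans h
  · rw [Nat.cast_add, Nat.cast_one, ENNReal.add_sub_cancel_right ENNReal.one_ne_top]
    exact natCast_le_dimH hlam hle hmu
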